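/- Let $\eta,u,q\in\mathbb{C}$ with $q\neq 0$, $q+q^{-1}\neq 0$, $\sinh(u+\eta)\neq 0$ and $\sinh(-u+\eta)\neq 0$, and let $N\ge 0$ be an integer. Let $$R(x)=\begin{pmatrix}1&0&0&0\\0&\frac{\sinh x}{\sinh(x+\eta)}&\frac{\sinh\eta}{\sinh(x+\eta)}&0\\0&\frac{\sinh\eta}{\sinh(x+\eta)}&\frac{\sinh x}{\sinh(x+\eta)}&0\\0&0&0&1\end{pmatrix}$$ act on $\mathbb{C}^2\otimes\mathbb{C}^2$, let $P$ be the exchange operator, and put $\rho(q)=\dfrac{q^{\sigma^z}}{q+q^{-1}}$. *Influence matrix.* Consider spins at the positions $-L,\dots,-1$ (the bath) and $0$ (the boundary spin). Let $U_{i,i+1}=P_{i,i+1}R_{i,i+1}(u)$ and let $U^+=U^+_{\mathrm{even}}U^+_{\mathrm{odd}}$, where $U^+_{\mathrm{odd}}$ is the product of the gates $U_{-1,0},U_{-3,-2},\dots$ and $U^+_{\mathrm{even}}$ is the product of the gates $U_{-2,-1},U_{-4,-3},\dots$, over all such gates that fit into the chain. With $\rho_b=\rho(q)^{\otimes L}$,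 with $\langle a|X|b\rangle$ denoting the bath operator obtained from $X$ by fixing the boundary spin, and with the trace over the bath, set $$\mathcal{I}^{\bar s_0,\dots,\bar s_{2N-1}}_{s_0,\dots,s_{2N-1}}=\mathrm{tr}\Big(\langle\bar s_{2N-1}|(U^+)^{-1}|\bar s_{2N-2}\rangle\cdots\langle\bar s_1|(U^+)^{-1}|\bar s_0\rangle\,\rho_b\,\langle s_0|U^+|s_1\rangle\cdots\langle s_{2N-2}|U^+|s_{2N-1}\rangle\Big).$$ Let $|\mathcal{I}\rangle\in(\mathbb{C}^2)^{\otimes 4N}$ be the vector with these components, the temporal sites $1,\dots,4N$ carrying $\bar s_{2N-1},\dots,\bar s_0,s_0,\dots,s_{2N-1}$ in this order. *Transfer matrix.* With an auxiliary site $0$ and $t_k$ the transposition in site $k$, let $$T(v)=\mathrm{tr}_0\Big(R_{4N,0}(u-v)\,R^{t_{4N-1}}_{0,4N-1}(v)\cdots R_{2N+2,0}(u-v)\,R^{t_{2N+1}}_{0,2N+1}(v)\;\rho_0(q)\;R_{2N,0}(-v)\,R^{t_{2N-1}}_{0,2N-1}(v-u)\cdots R_{2,0}(-v)\,R^{t_1}_{0,1}(v-u)\Big).$$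 *Claim.* The vector $|\mathcal{I}\rangle$ is the same for all $L\ge 2N$ (so it is the influence matrix of the semi-infinite bath). For every $v\in\mathbb{C}$ at which the entries of the $R$-matrices in $T(v)$ have no pole, that is, with $\sinh(v+\eta)$, $\sinh(-v+\eta)$, $\sinh(u-v+\eta)$ and $\sinh(v-u+\eta)$ all nonzero, $|\mathcal{I}\rangle$ is an eigenvector of $T(v)$ with eigenvalue $1$: $|\mathcal{I}\rangle\neq 0$ and $T(v)|\mathcal{I}\rangle=|\mathcal{I}\rangle$. -/

import Mathlib

namespace XXZFloquet

noncomputable section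

/-- The XXZ `R`-matrix on `ℂ² ⊗ ℂ²`, in the basis `00, 01, 10, 11`
(`0` is spin up, `1` is spin down; the first entry of a pair is the first tensor factor). -/
def rMatrix (η u : ℂ) : Matrix (Fin 2 × Fin 2) (Fin 2 × Fin 2) ℂ :=
  let b := Complex.sinh u / Complex.sinh (u + η)
  let c := Complex.sinh η / Complex.sinh (u + η)
  fun x y =>
    (!![1, 0, 0, 0;
        0, b, c, 0;
        0, c, b, 0;
        0, 0, 0, 1] : Matrix (Fin 4) (Fin 4) ℂ) (finProdFinEquiv x) (finProdFinEquiv y)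

/-- The gate placed at the crossing of two lines, as an operator on the two chain positions:
`Ř(u) = P R(u)`, where `P` exchanges the two factors. -/
def gate (η u : ℂ) : Matrix (Fin 2 × Fin 2) (Fin 2 × Fin 2) ℂ :=
  fun x y => rMatrix η u x.swap y

/-- Transposition in the second tensor factor. -/
def transposeSnd (g : Matrix (Fin 2 × Fin 2) (Fin 2 × Fin 2) ℂ) :
    Matrix (Fin 2 × Fin 2) (Fin 2 × Fin 2) ℂ :=
  fun x y => g (x.1, y.2) (y.1, x.2)

/-- The one-site density matrix `q ^ σᶻ / (q + q⁻¹)`. -/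
def rho (q : ℂ) : Matrix (Fin 2) (Fin 2) ℂ :=
  (q + q⁻¹)⁻¹ • Matrix.diagonal ![q, q⁻¹]

/-- The operator `g` on the sites `a` (first factor) and `b` (second factor) of a chain of `n`
spins, acting trivially on all other sites; used for `a ≠ b`. -/
def onSites {n : ℕ} (a b : Fin n) (g : Matrix (Fin 2 × Fin 2) (Fin 2 × Fin 2) ℂ) :
    Matrix (Fin n → Fin 2) (Fin n → Fin 2) ℂ :=
  fun σ τ => if ∀ k, k ≠ a → k ≠ b → σ k = τ k then g (σ a, σ b) (τ a, τ b) else 0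

/-- The operator `g` on the site `a` of a chain of `n` spins. -/
def onSite {n : ℕ} (a : Fin n) (g : Matrix (Fin 2) (Fin 2) ℂ) :
    Matrix (Fin n → Fin 2) (Fin n → Fin 2) ℂ :=
  fun σ τ => if ∀ k, k ≠ a → σ k = τ k then g (σ a) (τ a) else 0

/-! ### The influence matrix

The boundary spin sits at position `0` and the bath consists of the positions `-1, …, -L`.
The index `j : Fin (L + 1)` stands for the position `-j`. -/

/-- The layer `∏ U_{2i-1,2i}` (`i ≤ 0`), which contains the gate `U_{-1,0}`.
The bond `j` joins the positions `-(j+1)` and `-j`. -/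
def oddLayer (L : ℕ) (η u : ℂ) : Matrix (Fin (L + 1) → Fin 2) (Fin (L + 1) → Fin 2) ℂ :=
  (List.ofFn fun j : Fin L =>
    if Even (j : ℕ) then onSites j.succ j.castSucc (gate η u) else 1).prod

/-- The layer `∏ U_{2i,2i+1}` (`i ≤ -1`). -/
def evenLayer (L : ℕ) (η u : ℂ) : Matrix (Fin (L + 1) → Fin 2) (Fin (L + 1) → Fin 2) ℂ :=
  (List.ofFn fun j : Fin L =>
    if Odd (j : ℕ) then onSites j.succ j.castSucc (gate η u) else 1).prod

/-- The half-chain Floquet operator `U⁺ = U⁺_even U⁺_odd`. -/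
def floquet (L : ℕ) (η u : ℂ) : Matrix (Fin (L + 1) → Fin 2) (Fin (L + 1) → Fin 2) ℂ :=
  evenLayer L η u * oddLayer L η u

/-- The bath operator `⟨a| M |b⟩`, where `a`, `b` are states of the boundary spin. -/
def boundaryElem {L : ℕ} (M : Matrix (Fin (L + 1) → Fin 2) (Fin (L + 1) → Fin 2) ℂ)
    (a b : Fin 2) : Matrix (Fin L → Fin 2) (Fin L → Fin 2) ℂ :=
  fun σ τ => M (Fin.cons a σ) (Fin.cons b τ)

/-- The bath density matrix `⨂ q ^ σᶻ / (q + q⁻¹)`. -/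
def rhoBath (L : ℕ) (q : ℂ) : Matrix (Fin L → Fin 2) (Fin L → Fin 2) ℂ :=
  fun σ τ => ∏ j, rho q (σ j) (τ j)

/-- `⟨s₀|U⁺|s₁⟩ ⟨s₂|U⁺|s₃⟩ ⋯ ⟨s_{2N-2}|U⁺|s_{2N-1}⟩`. -/
def forwardBranch (N L : ℕ) (η u : ℂ) (s : Fin (2 * N) → Fin 2) :
    Matrix (Fin L → Fin 2) (Fin L → Fin 2) ℂ :=
  (List.ofFn fun k : Fin N =>
    boundaryElem (floquet L η u) (s ⟨2 * (k : ℕ), by omega⟩) (s ⟨2 * (k : ℕ) + 1, by omega⟩)).prod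

/-- `⟨s̄_{2N-1}|(U⁺)⁻¹|s̄_{2N-2}⟩ ⋯ ⟨s̄₃|(U⁺)⁻¹|s̄₂⟩ ⟨s̄₁|(U⁺)⁻¹|s̄₀⟩`. -/
def backwardBranch (N L : ℕ) (η u : ℂ) (t : Fin (2 * N) → Fin 2) :
    Matrix (Fin L → Fin 2) (Fin L → Fin 2) ℂ :=
  (List.ofFn fun k : Fin N =>
    boundaryElem (floquet L η u)⁻¹ (t ⟨2 * (k : ℕ) + 1, by omega⟩) (t ⟨2 * (k : ℕ), by omega⟩)).reverse.prod

/-- The influence matrix of a bath of `L` spins on the boundary trajectories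
`s` (forward) and `t` (backward). -/
def influenceMatrix (N L : ℕ) (η u q : ℂ) (s t : Fin (2 * N) → Fin 2) : ℂ :=
  (backwardBranch N L η u t * rhoBath L q * forwardBranch N L η u s).trace

/-- The vectorized influence matrix on `4N` temporal sites, ordered as
`s̄_{2N-1}, …, s̄₀, s₀, …, s_{2N-1}`. -/
def influenceVector (N L : ℕ) (η u q : ℂ) : (Fin (4 * N) → Fin 2) → ℂ :=
  fun w => influenceMatrix N L η u q
    (fun i => w ⟨2 * N + (i : ℕ), by omega⟩) (fun i => w ⟨2 * N - 1 - (i : ℕ), by omega⟩)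

/-! ### The auxiliary transfer matrix

The index `0 : Fin (4 * N + 1)` is the auxiliary site, and `1, …, 4N` are the temporal sites. -/

/-- The factor attached to the temporal site `k`: `R_{k,0}(u-v)` and `R^{t_k}_{0,k}(v)` for even
and odd `k > 2N`, and `R_{k,0}(-v)` and `R^{t_k}_{0,k}(v-u)` for even and odd `k ≤ 2N`. -/
def siteFactor (N : ℕ) (η u v : ℂ) (k : Fin (4 * N + 1)) :
    Matrix (Fin (4 * N + 1) → Fin 2) (Fin (4 * N + 1) → Fin 2) ℂ :=
  if 2 * N < (k : ℕ) then
    if Even (k : ℕ) then onSites k 0 (rMatrix η (u - v))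
    else onSites 0 k (transposeSnd (rMatrix η v))
  else
    if Even (k : ℕ) then onSites k 0 (rMatrix η (-v))
    else onSites 0 k (transposeSnd (rMatrix η (v - u)))

/-- The product of the factors of the sites `4N, …, 2N+1`, then `ρ₀(q)`, then the factors of the
sites `2N, …, 1`. -/
def monodromy (N : ℕ) (η u q v : ℂ) :
    Matrix (Fin (4 * N + 1) → Fin 2) (Fin (4 * N + 1) → Fin 2) ℂ :=
  (List.ofFn fun m : Fin (2 * N) =>
    siteFactor N η u v ⟨2 * N + 1 + (m : ℕ), by omega⟩).reverse.prod *
  onSite 0 (rho q) *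
  (List.ofFn fun m : Fin (2 * N) => siteFactor N η u v ⟨1 + (m : ℕ), by omega⟩).reverse.prod

/-- The transfer matrix `T(v)`: the trace of the monodromy over the auxiliary site. -/
def transferMatrix (N : ℕ) (η u q v : ℂ) :
    Matrix (Fin (4 * N) → Fin 2) (Fin (4 * N) → Fin 2) ℂ :=
  fun w w' => ∑ a : Fin 2, monodromy N η u q v (Fin.cons a w) (Fin.cons a w')

end

end XXZFloquet

namespace XXZFloquet

noncomputable section

open scoped Matrix

/-! Add one more spin `c`, in the state ρ(q), beyond the far end of a bath of 2N spins, and replace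
U⁺ by the dressed coupling R_{c,0}(v) U⁺ R_{0,c}(u-v). The influence functional of this coupling can
be evaluated in two ways.

Summing over the boundary states between the R-matrices and U⁺ gives the bare influence functional
weighted by a product of 2×2 matrices on `c`, closed by a trace with ρ(q). This kernel is T(v), so
the dressed functional is T(v)|I⟩ (`influence_dressedFloquet_eq_sum`, `transferMatrix_apply`).

On the other hand, `c` can be removed. The Yang–Baxter equation carries its line from site 0 into
the bath, two sites at a time (`extLayer_zipper`, `influence_line_step`). Each move costs a
conjugation by a bath operator, which is invisible: inner conjugations cancel, the outer one is
absorbed by cyclicity of the trace, and charge conservation makes it commute with the bath state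
(`influence_conj`, `onSites_commute_rhoBath`). At site 2N the line is outside the light cone of the
boundary: with invertible gates each layer spreads an operator by only one site, so N time steps do
not see it (`actsBelow_pathOp_and_eq`). Then `c` decouples and contributes tr ρ(q) = 1. Hence
T(v)|I⟩ = |I⟩.

The same light-cone argument gives independence of L, since a longer bath differs by a far gate
(`floquet_succ`). The vector is nonzero because suitable components sum to tr ρ_b = 1
(`sum_pathOp_diagonal`). -/

/-- Operators on a chain of `n` spins. -/
abbrev ChainOp (n : ℕ) := Matrix (Fin n → Fin 2) (Fin n → Fin 2) ℂ

/-- Operators on two spins. -/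
abbrev PairOp := Matrix (Fin 2 × Fin 2) (Fin 2 × Fin 2) ℂ

/-! ### Operators supported on selected sites -/

/-- The operator on `n` spins that acts as `h` on the spins in the range of `f`. -/
def embedSites {m n : ℕ} (f : Fin m → Fin n) (h : ChainOp m) : ChainOp n :=
  fun σ τ => if ∀ k, (∀ i, f i ≠ k) → σ k = τ k then h (σ ∘ f) (τ ∘ f) else 0

/-- The configurations that agree with `σ` off the range of `f` are parametrized by their values on
that range. This collapses the intermediate sum in a product with an embedded operator. -/
theorem sum_agree {m n : ℕ} {f : Fin m → Fin n} (hf : Function.Injective f) (σ : Fin n → Fin 2)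
    (F : (Fin n → Fin 2) → ℂ) :
    (∑ μ, if ∀ k, (∀ i, f i ≠ k) → σ k = μ k then F μ else 0) =
      ∑ x : Fin m → Fin 2, F (Function.extend f x σ) := by
  rw [← Finset.sum_filter]
  refine Finset.sum_nbij' (fun μ => μ ∘ f) (fun x => Function.extend f x σ) ?_ ?_ ?_ ?_ ?_
  · simp
  · intro x _
    simp only [Finset.mem_filter, Finset.mem_univ, true_and]
    intro k hk
    rw [Function.extend_apply' _ _ _ (by rintro ⟨i, hi⟩; exact hk i hi)]
  · intro μ hμ
    simp only [Finset.mem_filter, Finset.mem_univ, true_and] at hμ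
    funext k
    by_cases hk : ∃ i, f i = k
    · obtain ⟨i, rfl⟩ := hk
      simp [hf.extend_apply]
    · rw [Function.extend_apply' _ _ _ hk]
      exact hμ k (fun i hi => hk ⟨i, hi⟩)
  · intro x _
    exact Function.extend_comp hf _ _
  · intro μ hμ
    simp only [Finset.mem_filter, Finset.mem_univ, true_and] at hμ
    congr 1
    funext k
    by_cases hk : ∃ i, f i = k
    · obtain ⟨i, rfl⟩ := hk
      simp [hf.extend_apply]
    · rw [Function.extend_apply' _ _ _ hk]
      exact (hμ k (fun i hi => hk ⟨i, hi⟩)).symm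

theorem embedSites_mul_apply {m n : ℕ} {f : Fin m → Fin n} (hf : Function.Injective f)
    (h : ChainOp m) (M : ChainOp n) (σ τ : Fin n → Fin 2) :
    (embedSites f h * M) σ τ = ∑ x, h (σ ∘ f) x * M (Function.extend f x σ) τ := by
  simp only [Matrix.mul_apply, embedSites, ite_mul, zero_mul]
  rw [sum_agree hf]
  simp [Function.extend_comp hf]

theorem embedSites_extend {m n : ℕ} {f : Fin m → Fin n} (hf : Function.Injective f)
    (h : ChainOp m) (x : Fin m → Fin 2) (σ τ : Fin n → Fin 2) :
    embedSites f h (Function.extend f x σ) τ =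
      if ∀ k, (∀ i, f i ≠ k) → σ k = τ k then h x (τ ∘ f) else 0 := by
  simp only [embedSites, Function.extend_comp hf]
  congr 1
  refine propext (forall_congr' fun k => forall_congr' fun hk => ?_)
  rw [Function.extend_apply' _ _ _ (by rintro ⟨i, hi⟩; exact hk i hi)]

theorem embedSites_mul {m n : ℕ} {f : Fin m → Fin n} (hf : Function.Injective f)
    (h h' : ChainOp m) : embedSites f (h * h') = embedSites f h * embedSites f h' := by
  ext σ τ
  rw [embedSites_mul_apply hf]
  simp only [embedSites_extend hf]
  by_cases hc : ∀ k, (∀ i, f i ≠ k) → σ k = τ k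
  · simp [embedSites, Matrix.mul_apply]
  · simp [embedSites, hc]

theorem embedSites_one {m n : ℕ} (f : Fin m → Fin n) : embedSites f (1 : ChainOp m) = 1 := by
  ext σ τ
  simp only [embedSites, Matrix.one_apply]
  by_cases h : σ = τ
  · simp [h]
  · rw [if_neg h, ← ite_and, if_neg]
    rintro ⟨h1, h2⟩
    apply h
    funext k
    by_cases hk : ∃ i, f i = k
    · obtain ⟨i, rfl⟩ := hk
      exact congrFun h2 i
    · exact h1 k (fun i hi => hk ⟨i, hi⟩)

/-- `embedSites` along an injective map, as a monoid homomorphism. -/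
def embedHom {m n : ℕ} {f : Fin m → Fin n} (hf : Function.Injective f) :
    ChainOp m →* ChainOp n where
  toFun := embedSites f
  map_one' := embedSites_one f
  map_mul' := embedSites_mul hf

theorem embedSites_embedSites {l m n : ℕ} {f : Fin m → Fin n} (hf : Function.Injective f)
    (g : Fin l → Fin m) (h : ChainOp l) :
    embedSites f (embedSites g h) = embedSites (f ∘ g) h := by
  ext σ τ
  simp only [embedSites, ← ite_and, Function.comp_apply, Function.comp_assoc]
  congr 1
  refine propext ⟨?_, ?_⟩
  · rintro ⟨h1, h2⟩ k hk
    by_cases hk' : ∃ i, f i = k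
    · obtain ⟨i, rfl⟩ := hk'
      exact h2 i fun j hj => hk j (by rw [hj])
    · exact h1 k (fun i hi => hk' ⟨i, hi⟩)
  · intro h1
    exact ⟨fun k hk => h1 k fun i => hk _, fun k hk => h1 _ fun i hi => hk i (hf hi)⟩

/-- With disjoint ranges only one intermediate configuration survives: `τ` on the range of `f`, `σ`
elsewhere. The resulting formula is symmetric in the two factors, which yields `embedSites_commute`.
-/
theorem embedSites_mul_embedSites_apply {l m n : ℕ} {f : Fin m → Fin n} {g : Fin l → Fin n}
    (hf : Function.Injective f) (hfg : ∀ i j, f i ≠ g j)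
    (h : ChainOp m) (h' : ChainOp l) (σ τ : Fin n → Fin 2) :
    (embedSites f h * embedSites g h') σ τ =
      if ∀ k, (∀ i, f i ≠ k) → (∀ j, g j ≠ k) → σ k = τ k then
        h (σ ∘ f) (τ ∘ f) * h' (σ ∘ g) (τ ∘ g) else 0 := by
  rw [embedSites_mul_apply hf, Finset.sum_eq_single (τ ∘ f)]
  · have h1 : Function.extend f (τ ∘ f) σ ∘ g = σ ∘ g := by
      funext j
      exact Function.extend_apply' _ _ _ (by rintro ⟨i, hi⟩; exact hfg i j hi)
    rw [embedSites, h1, mul_ite, mul_zero]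
    congr 1
    refine propext ⟨fun H k hk hk' => ?_, fun H k hk => ?_⟩
    · rw [← H k hk', Function.extend_apply' _ _ _ (by rintro ⟨i, hi⟩; exact hk i hi)]
    · by_cases hk' : ∃ i, f i = k
      · obtain ⟨i, rfl⟩ := hk'
        simp [hf.extend_apply]
      · rw [Function.extend_apply' _ _ _ hk']
        exact H k (fun i hi => hk' ⟨i, hi⟩) hk
  · intro x _ hx
    rw [embedSites, if_neg, mul_zero]
    intro H
    apply hx
    funext i
    rw [← hf.extend_apply x σ i]
    exact H (f i) fun j hj => hfg i j hj.symm
  · simp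

theorem embedSites_commute {l m n : ℕ} {f : Fin m → Fin n} {g : Fin l → Fin n}
    (hf : Function.Injective f) (hg : Function.Injective g) (hfg : ∀ i j, f i ≠ g j)
    (h : ChainOp m) (h' : ChainOp l) : Commute (embedSites f h) (embedSites g h') := by
  ext σ τ
  rw [embedSites_mul_embedSites_apply hf hfg,
    embedSites_mul_embedSites_apply hg fun i j => (hfg j i).symm, mul_comm]
  congr 1
  exact propext ⟨fun H k hk hk' => H k hk' hk, fun H k hk hk' => H k hk' hk⟩

/-- A two-spin operator as an operator on the chain of length two. -/
def pairOp (g : PairOp) : ChainOp 2 := fun x y => g (x 0, x 1) (y 0, y 1)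

theorem pair_injective {n : ℕ} {a b : Fin n} (hab : a ≠ b) :
    Function.Injective (![a, b] : Fin 2 → Fin n) := by
  intro i j
  fin_cases i <;> fin_cases j <;> simp [hab, hab.symm]

theorem onSites_eq_embedSites {n : ℕ} (a b : Fin n) (g : PairOp) :
    onSites a b g = embedSites ![a, b] (pairOp g) := by
  ext σ τ
  simp only [onSites, embedSites, pairOp, Function.comp_apply, Fin.forall_fin_two,
    Matrix.cons_val_zero, Matrix.cons_val_one]
  congr 1
  refine propext (forall_congr' fun k => ?_)
  rw [and_imp, ne_comm, ne_comm (a := b)]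

theorem embedSites_onSites {m n : ℕ} {f : Fin m → Fin n} (hf : Function.Injective f)
    (a b : Fin m) (g : PairOp) : embedSites f (onSites a b g) = onSites (f a) (f b) g := by
  rw [onSites_eq_embedSites, onSites_eq_embedSites, embedSites_embedSites hf]
  congr 1
  funext i
  fin_cases i <;> rfl

theorem pairOp_mul (g h : PairOp) : pairOp (g * h) = pairOp g * pairOp h := by
  ext x y
  simp only [pairOp, Matrix.mul_apply]
  exact (Fintype.sum_equiv (finTwoArrowEquiv (Fin 2)) _ _ fun z => rfl).symm

theorem pairOp_one : pairOp 1 = 1 := by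
  ext x y
  simp only [pairOp, Matrix.one_apply]
  congr 1
  rw [Prod.ext_iff, funext_iff, Fin.forall_fin_two]

theorem onSites_mul {n : ℕ} {a b : Fin n} (hab : a ≠ b) (g h : PairOp) :
    onSites a b (g * h) = onSites a b g * onSites a b h := by
  simp only [onSites_eq_embedSites, pairOp_mul, embedSites_mul (pair_injective hab)]

theorem onSites_one {n : ℕ} (a b : Fin n) : onSites a b 1 = 1 := by
  rw [onSites_eq_embedSites, pairOp_one, embedSites_one]

theorem onSites_commute {n : ℕ} {a b c d : Fin n} (hab : a ≠ b) (hcd : c ≠ d)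
    (hac : a ≠ c) (had : a ≠ d) (hbc : b ≠ c) (hbd : b ≠ d) (g h : PairOp) :
    Commute (onSites a b g) (onSites c d h) := by
  rw [onSites_eq_embedSites, onSites_eq_embedSites]
  refine embedSites_commute (pair_injective hab) (pair_injective hcd) ?_ _ _
  simp only [Fin.forall_fin_two]
  exact ⟨⟨hac, had⟩, hbc, hbd⟩

/-- Exchange of the two factors of a two-spin operator. -/
def swapOp (g : PairOp) : PairOp := fun x y => g x.swap y.swap

theorem onSites_swap {n : ℕ} (a b : Fin n) (g : PairOp) :
    onSites a b (swapOp g) = onSites b a g := by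
  ext σ τ
  simp only [onSites, swapOp, Prod.swap_prod_mk]
  congr 1
  exact propext ⟨fun H k hk hk' => H k hk' hk, fun H k hk hk' => H k hk' hk⟩

/-! ### The six-vertex matrix: symmetries, unitarity, charge conservation -/

/-- The six-vertex matrix with weights `1`, `b`, `c`. -/
def sixVertex (b c : ℂ) : PairOp := fun x y =>
  if x = y then (if x.1 = x.2 then 1 else b) else if x = y.swap then c else 0

theorem rMatrix_eq_sixVertex (η u : ℂ) :
    rMatrix η u =
      sixVertex (Complex.sinh u / Complex.sinh (u + η)) (Complex.sinh η / Complex.sinh (u + η)) := by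
  ext ⟨i, j⟩ ⟨k, l⟩
  fin_cases i <;> fin_cases j <;> fin_cases k <;> fin_cases l <;>
    simp [rMatrix, sixVertex, finProdFinEquiv]

theorem sixVertex_comm (b c : ℂ) (x y : Fin 2 × Fin 2) :
    sixVertex b c x y = sixVertex b c y x := by
  revert x y
  simp only [Prod.forall, Fin.forall_fin_two]
  simp [sixVertex]

theorem swapOp_sixVertex (b c : ℂ) : swapOp (sixVertex b c) = sixVertex b c := by
  ext ⟨i, j⟩ ⟨k, l⟩
  fin_cases i <;> fin_cases j <;> fin_cases k <;> fin_cases l <;> simp [swapOp, sixVertex]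

theorem sixVertex_mul (b c b' c' : ℂ) (h1 : b * b' + c * c' = 1) (h2 : b * c' + c * b' = 0) :
    sixVertex b c * sixVertex b' c' = 1 := by
  ext ⟨i, j⟩ ⟨k, l⟩
  fin_cases i <;> fin_cases j <;> fin_cases k <;> fin_cases l <;>
    simp [sixVertex, Matrix.mul_apply, Fintype.sum_prod_type, h1, h2] <;>
    first | linear_combination h1 | linear_combination h2

/-- Unitarity comes down to sinh(η+x) sinh(η-x) = sinh²η - sinh²x. -/
theorem rMatrix_mul_neg {η x : ℂ} (h : Complex.sinh (x + η) ≠ 0)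
    (h' : Complex.sinh (-x + η) ≠ 0) : rMatrix η x * rMatrix η (-x) = 1 := by
  rw [rMatrix_eq_sixVertex, rMatrix_eq_sixVertex]
  have e1 := Complex.sinh_add x η
  have e2 := Complex.sinh_add (-x) η
  have c1 := Complex.cosh_sq x
  have c2 := Complex.cosh_sq η
  rw [Complex.sinh_neg, Complex.cosh_neg] at e2
  apply sixVertex_mul <;> rw [Complex.sinh_neg] <;> field_simp
  · rw [e1, e2]
    linear_combination (Complex.sinh x) ^ 2 * c2 - (Complex.sinh η) ^ 2 * c1
  · ring

theorem rMatrix_comm (η u : ℂ) (x y : Fin 2 × Fin 2) : rMatrix η u x y = rMatrix η u y x := by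
  rw [rMatrix_eq_sixVertex, sixVertex_comm]

theorem swapOp_rMatrix (η u : ℂ) : swapOp (rMatrix η u) = rMatrix η u := by
  rw [rMatrix_eq_sixVertex, swapOp_sixVertex]

theorem onSites_rMatrix_swap {n : ℕ} (a b : Fin n) (η u : ℂ) :
    onSites a b (rMatrix η u) = onSites b a (rMatrix η u) := by
  conv_lhs => rw [← swapOp_rMatrix, onSites_swap]

theorem gate_mul_gate_neg {η x : ℂ} (h : Complex.sinh (x + η) ≠ 0)
    (h' : Complex.sinh (-x + η) ≠ 0) : gate η x * gate η (-x) = 1 := by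
  rw [← rMatrix_mul_neg h h']
  ext y z
  simp only [Matrix.mul_apply, gate]
  refine Fintype.sum_equiv (Equiv.prodComm _ _) _ _ fun w => ?_
  have := congrFun (congrFun (swapOp_rMatrix η x) y) w.swap
  simp only [swapOp, Prod.swap_swap] at this
  simp [this]

/-- A two-spin operator that conserves the number of down spins. -/
def ConservesCharge (g : PairOp) : Prop :=
  ∀ x y, g x y ≠ 0 → x = y ∨ x = y.swap

theorem conservesCharge_rMatrix (η u : ℂ) : ConservesCharge (rMatrix η u) := by
  intro x y h
  rw [rMatrix_eq_sixVertex] at h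
  by_contra! H
  simp [sixVertex, H.1, H.2] at h

/-! ### The Yang–Baxter equation -/

theorem vec3_eq (σ : Fin 3 → Fin 2) : σ = ![σ 0, σ 1, σ 2] := by
  funext i
  fin_cases i <;> rfl

theorem sum_fin_three_arrow (F : (Fin 3 → Fin 2) → ℂ) :
    ∑ μ : Fin 3 → Fin 2, F μ = ∑ x : Fin 2, ∑ y : Fin 2, ∑ z : Fin 2, F ![x, y, z] := by
  rw [← Fintype.sum_prod_type', ← Fintype.sum_prod_type']
  let e : (Fin 3 → Fin 2) ≃ (Fin 2 × Fin 2) × Fin 2 :=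
    ⟨fun μ => ((μ 0, μ 1), μ 2), fun x => ![x.1.1, x.1.2, x.2], fun μ => (vec3_eq μ).symm,
      fun x => rfl⟩
  exact Fintype.sum_equiv e F _ fun μ => congrArg F (vec3_eq μ)

theorem onSites_zero_one_mul_apply (g : PairOp) (M : ChainOp 3) (i j k : Fin 2)
    (τ : Fin 3 → Fin 2) :
    ((onSites 0 1 g : ChainOp 3) * M) ![i, j, k] τ = ∑ x, ∑ y, g (i, j) (x, y) * M ![x, y, k] τ := by
  fin_cases k <;> simp [Matrix.mul_apply, sum_fin_three_arrow, onSites, Fin.forall_fin_succ]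

theorem onSites_zero_two_mul_apply (g : PairOp) (M : ChainOp 3) (i j k : Fin 2)
    (τ : Fin 3 → Fin 2) :
    ((onSites 0 2 g : ChainOp 3) * M) ![i, j, k] τ = ∑ x, ∑ y, g (i, k) (x, y) * M ![x, j, y] τ := by
  fin_cases j <;> simp [Matrix.mul_apply, sum_fin_three_arrow, onSites, Fin.forall_fin_succ]

theorem onSites_two_one_mul_apply (g : PairOp) (M : ChainOp 3) (i j k : Fin 2)
    (τ : Fin 3 → Fin 2) :
    ((onSites 2 1 g : ChainOp 3) * M) ![i, j, k] τ = ∑ x, ∑ y, g (k, j) (x, y) * M ![i, y, x] τ := by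
  simp [Matrix.mul_apply, sum_fin_three_arrow, onSites, Fin.forall_fin_succ]
  fin_cases i <;> simp [add_comm, add_left_comm, add_assoc]

/-- Each of the 64 entries is trivial or one of the three weight relations. The middle factor lists
its weights as `c₂ b₂` because the exchange in the gate interchanges them. The trailing `1` lets
every entry be computed by three successive left multiplications. -/
theorem yang_baxter_of_weights {b₁ c₁ b₂ c₂ b₃ c₃ : ℂ}
    (h₁ : c₂ = b₁ * b₃ * c₂ + c₁ * c₃) (h₂ : b₂ * c₃ = b₃ * c₂ * c₁ + c₃ * b₁)
    (h₃ : b₂ * c₁ = b₁ * c₂ * c₃ + c₁ * b₃) :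
    (onSites 0 1 (sixVertex b₁ c₁) : ChainOp 3) * (onSites 2 1 (sixVertex c₂ b₂) *
        (onSites 0 1 (sixVertex b₃ c₃) * 1)) =
      onSites 0 2 (sixVertex b₃ c₃) * (onSites 2 1 (sixVertex c₂ b₂) *
        (onSites 0 2 (sixVertex b₁ c₁) * 1)) := by
  ext σ τ
  rw [vec3_eq σ, vec3_eq τ]
  generalize σ 0 = i, σ 1 = j, σ 2 = k, τ 0 = i', τ 1 = j', τ 2 = k'
  simp only [onSites_zero_one_mul_apply, onSites_zero_two_mul_apply, onSites_two_one_mul_apply]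
  revert i j k i' j' k'
  simp only [Fin.forall_fin_two, Fin.sum_univ_two, Matrix.one_apply]
  simp [sixVertex]
  and_intros
  all_goals
    first
      | ring1
      | linear_combination h₁
      | linear_combination -h₁
      | linear_combination h₂
      | linear_combination -h₂
      | linear_combination h₃
      | linear_combination -h₃

theorem gate_eq_sixVertex (η u : ℂ) :
    gate η u =
      sixVertex (Complex.sinh η / Complex.sinh (u + η)) (Complex.sinh u / Complex.sinh (u + η)) := by
  ext ⟨i, j⟩ ⟨k, l⟩
  fin_cases i <;> fin_cases j <;> fin_cases k <;> fin_cases l <;>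
    simp [gate, rMatrix_eq_sixVertex, sixVertex]

theorem yang_baxter_three {η u v : ℂ} (hu : Complex.sinh (u + η) ≠ 0)
    (hv : Complex.sinh (v + η) ≠ 0) (huv : Complex.sinh (u - v + η) ≠ 0) :
    (onSites 0 1 (rMatrix η v) : ChainOp 3) * onSites 2 1 (gate η u) *
        onSites 1 0 (rMatrix η (u - v)) =
      onSites 2 0 (rMatrix η (u - v)) * onSites 2 1 (gate η u) * onSites 0 2 (rMatrix η v) := by
  rw [onSites_rMatrix_swap 1 0, onSites_rMatrix_swap 2 0, gate_eq_sixVertex,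
    rMatrix_eq_sixVertex, rMatrix_eq_sixVertex]
  have key := yang_baxter_of_weights (b₁ := Complex.sinh v / Complex.sinh (v + η))
    (c₁ := Complex.sinh η / Complex.sinh (v + η)) (b₂ := Complex.sinh u / Complex.sinh (u + η))
    (c₂ := Complex.sinh η / Complex.sinh (u + η))
    (b₃ := Complex.sinh (u - v) / Complex.sinh (u - v + η))
    (c₃ := Complex.sinh η / Complex.sinh (u - v + η))
  simp only [mul_one, ← mul_assoc] at key
  -- With the difference `w` as a variable, the addition formulas turn the weight relations into
  -- polynomial identities modulo cosh² = sinh² + 1.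
  obtain ⟨w, rfl⟩ : ∃ w, u = v + w := ⟨u - v, by ring⟩
  rw [add_sub_cancel_left] at *
  have cv := Complex.cosh_sq v
  have cw := Complex.cosh_sq w
  have ce := Complex.cosh_sq η
  have e1 := Complex.sinh_add (v + w) η
  have e2 := Complex.sinh_add v η
  have e3 := Complex.sinh_add w η
  rw [Complex.sinh_add v w, Complex.cosh_add v w] at e1
  refine key ?_ ?_ ?_
  · field_simp
    rw [e1, e2, e3]
    linear_combination Complex.sinh η * Complex.sinh v * Complex.sinh w * ce
  · field_simp
    rw [e1, e2, Complex.sinh_add v w]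
    linear_combination Complex.sinh η ^ 2 * Complex.sinh w * cv
  · field_simp
    rw [e1, e3, Complex.sinh_add v w]
    linear_combination Complex.sinh η ^ 2 * Complex.sinh v * cw

/-- The local move of the line `c`: attached to `a` on both sides of a gate, it becomes attached to
`b`, and the two spectral parameters change sides. -/
theorem yang_baxter {n : ℕ} {c a b : Fin n} (hca : c ≠ a) (hcb : c ≠ b) (hab : a ≠ b)
    {η u v : ℂ} (hu : Complex.sinh (u + η) ≠ 0)
    (hv : Complex.sinh (v + η) ≠ 0) (huv : Complex.sinh (u - v + η) ≠ 0) :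
    onSites c a (rMatrix η v) * onSites b a (gate η u) * onSites a c (rMatrix η (u - v)) =
      onSites b c (rMatrix η (u - v)) * onSites b a (gate η u) * onSites c b (rMatrix η v) := by
  have hf : Function.Injective (![c, a, b] : Fin 3 → Fin n) := by
    intro i j
    fin_cases i <;> fin_cases j <;> simp [hca, hcb, hab, hca.symm, hcb.symm, hab.symm]
  have h := congrArg (embedSites ![c, a, b]) (yang_baxter_three hu hv huv)
  simp only [embedSites_mul hf, embedSites_onSites hf] at h
  exact h

/-! ### Nested products -/

/-- The product `F (p 0) ⋯ F (p (n - 1)) * B (p (n - 1)) ⋯ B (p 0)`. -/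
def nestedProd {α M : Type*} [Monoid M] (F B : α → M) : (n : ℕ) → (Fin n → α) → M
  | 0, _ => 1
  | n + 1, p => F (p 0) * nestedProd F B n (Fin.tail p) * B (p 0)

theorem nestedProd_eq {α M : Type*} [Monoid M] (F B : α → M) (n : ℕ) (p : Fin n → α) :
    nestedProd F B n p =
      (List.ofFn fun k => F (p k)).prod * (List.ofFn fun k => B (p k)).reverse.prod := by
  induction n with
  | zero => simp [nestedProd]
  | succ n ih => simp [nestedProd, ih, List.ofFn_succ, Fin.tail, mul_assoc]

theorem nestedProd_conj {α M : Type*} [Monoid M] (F B : α → M) {A A' : M} (h : A * A' = 1)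
    (h' : A' * A = 1) (n : ℕ) (p : Fin n → α) :
    nestedProd (fun a => A * F a * A') (fun a => A * B a * A') n p =
      A * nestedProd F B n p * A' := by
  induction n with
  | zero => simp [nestedProd, h]
  | succ n ih =>
    simp only [nestedProd, ih]
    simp only [mul_assoc]
    rw [← mul_assoc A' A, h', one_mul, ← mul_assoc A' A, h', one_mul]

theorem map_nestedProd {α M M' : Type*} [Monoid M] [Monoid M'] (φ : M →* M') (F B : α → M)
    (n : ℕ) (p : Fin n → α) :
    φ (nestedProd F B n p) = nestedProd (fun a => φ (F a)) (fun a => φ (B a)) n p := by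
  induction n with
  | zero => simp [nestedProd]
  | succ n ih => simp [nestedProd, ih]

/-! ### Matrix elements in the boundary spin -/

theorem sum_cons {L : ℕ} (F : (Fin (L + 1) → Fin 2) → ℂ) :
    ∑ μ, F μ = ∑ r : Fin 2, ∑ ν : Fin L → Fin 2, F (Fin.cons r ν) := by
  rw [← Fintype.sum_prod_type']
  exact (Fintype.sum_equiv (Fin.consEquiv fun _ => Fin 2) _ _ fun x => rfl).symm

theorem boundaryElem_mul {L : ℕ} (A B : ChainOp (L + 1)) (a b : Fin 2) :
    boundaryElem (A * B) a b = ∑ r, boundaryElem A a r * boundaryElem B r b := by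
  ext σ τ
  simp only [boundaryElem, Matrix.mul_apply, sum_cons, Matrix.sum_apply]

theorem boundaryElem_embedSites_succ {L : ℕ} (X : ChainOp L) (a b : Fin 2) :
    boundaryElem (embedSites Fin.succ X) a b = if a = b then X else 0 := by
  ext σ τ
  have h1 : (∀ k : Fin (L + 1), (∀ i : Fin L, i.succ ≠ k) →
      (Fin.cons a σ : Fin (L + 1) → Fin 2) k = (Fin.cons b τ : Fin (L + 1) → Fin 2) k) ↔ a = b := by
    constructor
    · intro h
      exact h 0 fun i => Fin.succ_ne_zero i
    · intro h k hk
      refine Fin.cases (by simpa using h) (fun i hi => absurd rfl (hi i)) k hk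
  simp only [boundaryElem, embedSites]
  rw [if_congr h1 rfl rfl]
  split_ifs <;> rfl

theorem boundaryElem_lift_mul {L : ℕ} (X : ChainOp L) (M : ChainOp (L + 1)) (a b : Fin 2) :
    boundaryElem (embedSites Fin.succ X * M) a b = X * boundaryElem M a b := by
  rw [boundaryElem_mul]
  simp [boundaryElem_embedSites_succ]

theorem boundaryElem_mul_lift {L : ℕ} (X : ChainOp L) (M : ChainOp (L + 1)) (a b : Fin 2) :
    boundaryElem (M * embedSites Fin.succ X) a b = boundaryElem M a b * X := by
  rw [boundaryElem_mul]
  simp [boundaryElem_embedSites_succ]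

theorem boundaryElem_one {L : ℕ} (a b : Fin 2) :
    boundaryElem (1 : ChainOp (L + 1)) a b = if a = b then 1 else 0 := by
  rw [← embedSites_one (Fin.succ : Fin L → Fin (L + 1)), boundaryElem_embedSites_succ]

/-- The operator `|a⟩⟨b|` on the boundary spin times `X` on the bath. -/
def boundaryUnit {L : ℕ} (a b : Fin 2) (X : ChainOp L) : ChainOp (L + 1) :=
  fun σ τ => if σ 0 = a ∧ τ 0 = b then X (Fin.tail σ) (Fin.tail τ) else 0

theorem boundaryElem_boundaryUnit {L : ℕ} (a b c d : Fin 2) (X : ChainOp L) :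
    boundaryElem (boundaryUnit a b X) c d = if c = a ∧ d = b then X else 0 := by
  ext σ τ
  simp only [boundaryElem, boundaryUnit, Fin.cons_zero, Fin.tail_cons]
  split_ifs <;> rfl

theorem boundaryElem_conj_boundaryUnit {L : ℕ} (M M' : ChainOp (L + 1)) (X : ChainOp L)
    (a b c d : Fin 2) :
    boundaryElem (M * boundaryUnit a b X * M') c d =
      boundaryElem M c a * X * boundaryElem M' b d := by
  simp [boundaryElem_mul, boundaryElem_boundaryUnit, ite_and, mul_ite]

theorem chainOp_ext {L : ℕ} {A B : ChainOp (L + 1)}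
    (h : ∀ a b, boundaryElem A a b = boundaryElem B a b) : A = B := by
  ext σ τ
  have := congrFun (congrFun (h (σ 0) (τ 0)) (Fin.tail σ)) (Fin.tail τ)
  simpa only [boundaryElem, Fin.cons_self_tail] using this

theorem lift_mul_boundaryUnit {L : ℕ} (X Y : ChainOp L) (a b : Fin 2) :
    embedSites Fin.succ X * boundaryUnit a b Y = boundaryUnit a b (X * Y) := by
  refine chainOp_ext fun c d => ?_
  rw [boundaryElem_lift_mul, boundaryElem_boundaryUnit, boundaryElem_boundaryUnit]
  split_ifs <;> simp

theorem boundaryUnit_mul_lift {L : ℕ} (X Y : ChainOp L) (a b : Fin 2) :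
    boundaryUnit a b Y * embedSites Fin.succ X = boundaryUnit a b (Y * X) := by
  refine chainOp_ext fun c d => ?_
  rw [boundaryElem_mul_lift, boundaryElem_boundaryUnit, boundaryElem_boundaryUnit]
  split_ifs <;> simp

/-! ### Influence functionals of a general boundary coupling -/

/-- The boundary states `((s, s'), (t', t))` entering one time step of the forward and of the
backward branch. -/
abbrev TimeStep := (Fin 2 × Fin 2) × (Fin 2 × Fin 2)

/-- The bath operator `⟨s₀|M|s₁⟩ ⋯ ⟨s_{2n-2}|M|s_{2n-1}⟩ ⟨t_{2n-1}|M⁻¹|t_{2n-2}⟩ ⋯ ⟨t₁|M⁻¹|t₀⟩`. -/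
def pathOp {L : ℕ} (M : ChainOp (L + 1)) (n : ℕ) (p : Fin n → TimeStep) : ChainOp L :=
  nestedProd (fun a => boundaryElem M a.1.1 a.1.2) (fun a => boundaryElem M⁻¹ a.2.1 a.2.2) n p

/-- The influence functional of the coupling `M` and the initial bath state `ρ`. -/
def influence {L : ℕ} (ρ : ChainOp L) (M : ChainOp (L + 1)) (n : ℕ) (p : Fin n → TimeStep) : ℂ :=
  (ρ * pathOp M n p).trace

theorem inv_conj {n : ℕ} {A A' : ChainOp n} (h : A * A' = 1) (M : ChainOp n) :
    (A * M * A')⁻¹ = A * M⁻¹ * A' := by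
  rw [Matrix.mul_inv_rev, Matrix.mul_inv_rev, Matrix.inv_eq_left_inv h, Matrix.inv_eq_right_inv h,
    mul_assoc]

/-- A bath operator commutes with fixing boundary states, so the conjugations of consecutive time
steps telescope. The outermost pair cancels by cyclicity of the trace, since `A` commutes with `ρ`.
-/
theorem influence_conj {L : ℕ} {ρ A A' : ChainOp L} (h : A * A' = 1) (h' : A' * A = 1)
    (hρ : Commute A ρ) (M : ChainOp (L + 1)) (n : ℕ) (p : Fin n → TimeStep) :
    influence ρ (embedSites Fin.succ A * M * embedSites Fin.succ A') n p = influence ρ M n p := by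
  have hl : embedSites Fin.succ A * embedSites Fin.succ A' = 1 := by
    rw [← embedSites_mul (Fin.succ_injective L), h, embedSites_one]
  unfold influence pathOp
  rw [inv_conj hl]
  simp only [boundaryElem_lift_mul, boundaryElem_mul_lift]
  rw [nestedProd_conj _ _ h h', ← mul_assoc, Matrix.trace_mul_comm, ← mul_assoc, ← mul_assoc,
    mul_assoc A' ρ, ← hρ.eq, ← mul_assoc, h', one_mul]

/-! ### Locality -/

/-- `X` commutes with every two-spin operator on sites that are at least `d`. -/
def ActsBelow {n : ℕ} (d : ℕ) (X : ChainOp n) : Prop :=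
  ∀ a b : Fin n, d ≤ (a : ℕ) → d ≤ (b : ℕ) → a ≠ b → ∀ g, Commute (onSites a b g) X

theorem ActsBelow.mono {n d e : ℕ} {X : ChainOp n} (hX : ActsBelow d X) (h : d ≤ e) :
    ActsBelow e X :=
  fun a b ha hb => hX a b (h.trans ha) (h.trans hb)

theorem actsBelow_one {n d : ℕ} : ActsBelow d (1 : ChainOp n) :=
  fun _ _ _ _ _ _ => Commute.one_right _

theorem ActsBelow.boundaryUnit {L d : ℕ} {X : ChainOp L} (hX : ActsBelow d X) (s t : Fin 2) :
    ActsBelow (d + 1) (boundaryUnit s t X) := by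
  intro a b
  refine Fin.cases (by simp) (fun a => ?_) a
  refine Fin.cases (by simp) (fun b => ?_) b
  intro ha hb hab g
  have := hX a b (by simpa using ha) (by simpa using hb) (by simpa using hab) g
  rw [← embedSites_onSites (Fin.succ_injective L), Commute, SemiconjBy, lift_mul_boundaryUnit,
    boundaryUnit_mul_lift, this.eq]

theorem ActsBelow.boundaryElem {L d : ℕ} {X : ChainOp (L + 1)} (hX : ActsBelow (d + 1) X)
    (s t : Fin 2) : ActsBelow d (boundaryElem X s t) := by
  intro a b ha hb hab g
  have := hX a.succ b.succ (by simpa using ha) (by simpa using hb) (by simpa using hab) g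
  rw [← embedSites_onSites (Fin.succ_injective L)] at this
  rw [Commute, SemiconjBy, ← boundaryElem_lift_mul, this.eq, boundaryElem_mul_lift]

/-- `X` is an invertible operator on the sites `j` and `j + 1`. -/
def IsBondGate {n : ℕ} (j : ℕ) (X : ChainOp n) : Prop :=
  ∃ a b : Fin n, (a : ℕ) = j + 1 ∧ (b : ℕ) = j ∧ ∃ g g' : PairOp, g * g' = 1 ∧ X = onSites a b g

theorem isUnit_onSites {n : ℕ} {a b : Fin n} (hab : a ≠ b) {g g' : PairOp} (h : g * g' = 1) :
    IsUnit (onSites a b g) :=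
  IsUnit.of_mul_eq_one (onSites a b g') (by rw [← onSites_mul hab, h, onSites_one])

theorem IsBondGate.isUnit {n j : ℕ} {X : ChainOp n} (h : IsBondGate j X) : IsUnit X := by
  obtain ⟨a, b, ha, hb, g, g', hg, rfl⟩ := h
  exact isUnit_onSites (fun h => by rw [h] at ha; omega) hg

theorem mul_inv_of_isUnit {n : ℕ} {X : ChainOp n} (h : IsUnit X) : X * X⁻¹ = 1 :=
  Matrix.mul_nonsing_inv _ ((Matrix.isUnit_iff_isUnit_det _).1 h)

theorem inv_mul_of_isUnit {n : ℕ} {X : ChainOp n} (h : IsUnit X) : X⁻¹ * X = 1 :=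
  Matrix.nonsing_inv_mul _ ((Matrix.isUnit_iff_isUnit_det _).1 h)

theorem conj_eq_of_commute {n : ℕ} {X Y : ChainOp n} (h : IsUnit X) (hc : Commute X Y) :
    X * Y * X⁻¹ = Y := by
  rw [hc.eq, mul_assoc, mul_inv_of_isUnit h, mul_one]

theorem commute_inv_right {n : ℕ} {X Y : ChainOp n} (h : IsUnit X) (hc : Commute Y X) :
    Commute Y X⁻¹ := by
  have h1 : X⁻¹ * (X * Y) * X⁻¹ = X⁻¹ * (Y * X) * X⁻¹ := by rw [hc.eq]
  rwa [← mul_assoc, inv_mul_of_isUnit h, one_mul, mul_assoc, mul_assoc, mul_inv_of_isUnit h,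
    mul_one] at h1

theorem isUnit_list_prod {M : Type*} [Monoid M] {l : List M} (h : ∀ x ∈ l, IsUnit x) :
    IsUnit l.prod := by
  induction l with
  | nil => simp
  | cons a l ih =>
    rw [List.prod_cons]
    exact (h a (by simp)).mul (ih fun x hx => h x (by simp [hx]))

theorem isUnit_bondGates {n m : ℕ} {G : Fin m → ChainOp n} (hG : ∀ j : Fin m, IsBondGate (j : ℕ) (G j)) :
    IsUnit (List.ofFn G).prod :=
  isUnit_list_prod fun x hx => by
    obtain ⟨j, rfl⟩ := (List.mem_ofFn' _ _).1 hx
    exact (hG j).isUnit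

/-- The light cone. The bonds are ordered increasingly, so the far gates are innermost in the
conjugation. They commute with `X` and cancel against their inverses one by one; the remaining bonds
are below `d` and touch sites up to `d` only. -/
theorem ActsBelow.conj_bondGates {n d : ℕ} {X : ChainOp n} (hX : ActsBelow d X) (m : ℕ)
    (G : Fin m → ChainOp n) (hG : ∀ j : Fin m, IsBondGate (j : ℕ) (G j)) :
    ActsBelow (d + 1) ((List.ofFn G).prod * X * (List.ofFn G).prod⁻¹) := by
  induction m with
  | zero => simpa using hX.mono (Nat.le_succ d)
  | succ m ih =>
    by_cases hm : m < d
    · intro a b ha hb hab g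
      have hu := isUnit_bondGates hG
      have hc : Commute (onSites a b g) (List.ofFn G).prod := by
        refine Commute.list_prod_right _ _ fun x hx => ?_
        obtain ⟨j, rfl⟩ := (List.mem_ofFn' _ _).1 hx
        obtain ⟨a', b', ha', hb', g', _, _, hj⟩ := hG j
        rw [hj]
        have := j.2
        apply onSites_commute hab <;> (rw [ne_eq, Fin.ext_iff]; omega)
      exact (hc.mul_right (hX.mono (Nat.le_succ d) a b ha hb hab g)).mul_right
        (commute_inv_right hu hc)
    · rw [List.ofFn_succ', List.concat_eq_append, List.prod_append, List.prod_singleton]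
      have hl := hG (Fin.last m)
      have hc : Commute (G (Fin.last m)) X := by
        obtain ⟨a', b', ha', hb', g', _, _, hj⟩ := hl
        rw [hj]
        refine hX _ _ ?_ ?_ ?_ _
        · simp at ha'; omega
        · simp at hb'; omega
        · rw [ne_eq, Fin.ext_iff]; omega
      rw [Matrix.mul_inv_rev, mul_assoc, mul_assoc, ← mul_assoc X, ← mul_assoc (G _),
        ← mul_assoc (G _), conj_eq_of_commute hl.isUnit hc, ← mul_assoc]
      exact ih _ fun j => hG j.castSucc

/-- Each time step conjugates the operator of the later steps, so the path operator is built from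
the latest time outwards. Between the layers `O` and `E` it meets `W`, which cancels as long as the
cone has not passed site 2N. -/
theorem actsBelow_pathOp_and_eq {L N : ℕ} {E O W : ChainOp (L + 1)} (hW : IsUnit W)
    (hEs : ∀ d X, ActsBelow d X → ActsBelow (d + 1) (E * X * E⁻¹))
    (hOs : ∀ d X, ActsBelow d X → ActsBelow (d + 1) (O * X * O⁻¹))
    (hWc : ∀ X, ActsBelow (2 * N) X → Commute W X) (n : ℕ) (hn : n ≤ N) (p : Fin n → TimeStep) :
    ActsBelow (2 * n) (pathOp (E * O) n p) ∧
      pathOp (E * W * O) n p = pathOp (E * O) n p := by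
  induction n with
  | zero => exact ⟨actsBelow_one, rfl⟩
  | succ n ih =>
    obtain ⟨ih1, ih2⟩ := ih (by omega) (Fin.tail p)
    simp only [pathOp] at ih1 ih2 ⊢
    simp only [nestedProd, ih2]
    set X := nestedProd (fun a : TimeStep => boundaryElem (E * O) a.1.1 a.1.2)
      (fun a => boundaryElem (E * O)⁻¹ a.2.1 a.2.2) n (Fin.tail p)
    simp only [← boundaryElem_conj_boundaryUnit]
    -- Bath site i is chain site i + 1, so the bound 2n becomes 2n + 1. The layer `O` raises it to
    -- 2n + 2 ≤ 2N, just enough for `W` to cancel. Then `E` adds one more, and removing the boundary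
    -- spin takes one off.
    have h1 := hOs _ _ (ih1.boundaryUnit (p 0).1.2 (p 0).2.1)
    have e1 : E * O * boundaryUnit (p 0).1.2 (p 0).2.1 X * (E * O)⁻¹ =
        E * (O * boundaryUnit (p 0).1.2 (p 0).2.1 X * O⁻¹) * E⁻¹ := by
      rw [Matrix.mul_inv_rev]
      simp only [mul_assoc]
    have e2 : E * W * O * boundaryUnit (p 0).1.2 (p 0).2.1 X * (E * W * O)⁻¹ =
        E * (W * (O * boundaryUnit (p 0).1.2 (p 0).2.1 X * O⁻¹) * W⁻¹) * E⁻¹ := by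
      rw [Matrix.mul_inv_rev, Matrix.mul_inv_rev]
      simp only [mul_assoc]
    rw [e1, e2, conj_eq_of_commute hW (hWc _ (h1.mono (by omega)))]
    exact ⟨((hEs _ _ h1).mono (by omega : 2 * n + 1 + 1 + 1 ≤ 2 * (n + 1) + 1)).boundaryElem _ _,
      rfl⟩

theorem influence_eq_of_far {L N : ℕ} (ρ : ChainOp L) {E O W : ChainOp (L + 1)} (hW : IsUnit W)
    (hEs : ∀ d X, ActsBelow d X → ActsBelow (d + 1) (E * X * E⁻¹))
    (hOs : ∀ d X, ActsBelow d X → ActsBelow (d + 1) (O * X * O⁻¹))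
    (hWc : ∀ X, ActsBelow (2 * N) X → Commute W X) (p : Fin N → TimeStep) :
    influence ρ (E * W * O) N p = influence ρ (E * O) N p := by
  rw [influence, influence, (actsBelow_pathOp_and_eq hW hEs hOs hWc N le_rfl p).2]

/-! ### The extended chain -/

/-- The gate of the bond `j` in a chain with one more site. -/
def extGate (L : ℕ) (η u : ℂ) (j : Fin L) : ChainOp (L + 2) :=
  onSites j.succ.castSucc j.castSucc.castSucc (gate η u)

/-- The gates of the bonds satisfying `p`, in a chain with one more site. -/
def extLayer (L : ℕ) (η u : ℂ) (p : ℕ → Prop) [DecidablePred p] : ChainOp (L + 2) :=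
  (List.ofFn fun j : Fin L => if p j then extGate L η u j else 1).prod

theorem embedSites_layer (L : ℕ) (η u : ℂ) (p : ℕ → Prop) [DecidablePred p] :
    embedSites Fin.castSucc (List.ofFn fun j : Fin L =>
      if p j then onSites j.succ j.castSucc (gate η u) else 1).prod = extLayer L η u p := by
  change embedHom (Fin.castSucc_injective (L + 1)) _ = _
  rw [map_list_prod, List.map_ofFn, extLayer]
  congr 2
  funext j
  simp only [Function.comp_apply]
  split_ifs
  · exact embedSites_onSites (Fin.castSucc_injective (L + 1)) _ _ _
  · exact map_one _

theorem embedSites_evenLayer (L : ℕ) (η u : ℂ) :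
    embedSites Fin.castSucc (evenLayer L η u) = extLayer L η u (fun j => Odd j) :=
  embedSites_layer L η u _

theorem embedSites_oddLayer (L : ℕ) (η u : ℂ) :
    embedSites Fin.castSucc (oddLayer L η u) = extLayer L η u (fun j => Even j) :=
  embedSites_layer L η u _

theorem embedSites_floquet (L : ℕ) (η u : ℂ) :
    embedSites Fin.castSucc (floquet L η u) =
      extLayer L η u (fun j => Odd j) * extLayer L η u (fun j => Even j) := by
  rw [floquet, embedSites_mul (Fin.castSucc_injective _), embedSites_evenLayer,
    embedSites_oddLayer]

theorem isBondGate_extGate {L : ℕ} {η u : ℂ} (hu : Complex.sinh (u + η) ≠ 0)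
    (hu' : Complex.sinh (-u + η) ≠ 0) (p : ℕ → Prop) [DecidablePred p] (j : Fin L) :
    IsBondGate (j : ℕ) (if p j then extGate L η u j else 1) := by
  refine ⟨j.succ.castSucc, j.castSucc.castSucc, by simp, by simp, ?_⟩
  by_cases h : p j
  · exact ⟨_, _, gate_mul_gate_neg hu hu', by rw [if_pos h]; rfl⟩
  · exact ⟨1, 1, one_mul 1, by rw [if_neg h, onSites_one]⟩

theorem commute_list_ofFn_prod {M : Type*} [Monoid M] {m : ℕ} {f : Fin m → M} {x : M}
    (h : ∀ j, Commute x (f j)) : Commute x (List.ofFn f).prod := by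
  refine Commute.list_prod_right _ _ fun y hy => ?_
  obtain ⟨j, rfl⟩ := (List.mem_ofFn' _ _).1 hy
  exact h j

/-- Only the factor `f j` interacts with the line; all others let it pass, so the exchange relation
at `j` extends to the whole product. -/
theorem list_ofFn_prod_zipper {M : Type*} [Monoid M] {A B A' B' : M} :
    ∀ {m : ℕ} (f : Fin m → M) (j : Fin m), (∀ i, i ≠ j → Commute A (f i)) →
      (∀ i, i ≠ j → Commute B (f i)) → (∀ i, i ≠ j → Commute A' (f i)) →
      (∀ i, i ≠ j → Commute B' (f i)) → A * f j * B = B' * f j * A' →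
      A * (List.ofFn f).prod * B = B' * (List.ofFn f).prod * A'
  | 0, _, j, _, _, _, _, _ => j.elim0
  | m + 1, f, j, hA, hB, hA', hB', h => by
    rw [List.ofFn_succ, List.prod_cons]
    induction j using Fin.cases with
    | zero =>
      have h1 : Commute B (List.ofFn fun i : Fin m => f i.succ).prod :=
        commute_list_ofFn_prod fun i => hB _ (Fin.succ_ne_zero i)
      have h2 : Commute A' (List.ofFn fun i : Fin m => f i.succ).prod :=
        commute_list_ofFn_prod fun i => hA' _ (Fin.succ_ne_zero i)
      rw [← mul_assoc, mul_assoc, ← h1.eq, ← mul_assoc, h, mul_assoc, h2.eq]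
      simp only [mul_assoc]
    | succ j =>
      have ih := list_ofFn_prod_zipper (fun i => f i.succ) j
        (fun i hi => hA _ (by simpa using hi)) (fun i hi => hB _ (by simpa using hi))
        (fun i hi => hA' _ (by simpa using hi)) (fun i hi => hB' _ (by simpa using hi)) h
      rw [← mul_assoc, (hA 0 (Fin.succ_ne_zero j).symm).eq, mul_assoc, mul_assoc,
        ← mul_assoc A, ih, ← mul_assoc, ← mul_assoc, ← mul_assoc,
        (hB' 0 (Fin.succ_ne_zero j).symm).eq]

theorem extLayer_commute {L : ℕ} {η u : ℂ} {p : ℕ → Prop} [DecidablePred p] {a b : Fin (L + 2)}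
    (hab : a ≠ b) (h : ∀ j : ℕ, p j → j < L →
      (a : ℕ) ≠ j ∧ (a : ℕ) ≠ j + 1 ∧ (b : ℕ) ≠ j ∧ (b : ℕ) ≠ j + 1)
    (g : PairOp) : Commute (onSites a b g) (extLayer L η u p) := by
  refine commute_list_ofFn_prod fun j => ?_
  split_ifs with hp
  · obtain ⟨h1, h2, h3, h4⟩ := h j hp j.2
    apply onSites_commute hab <;> (rw [ne_eq, Fin.ext_iff]; simp; try assumption)
  · exact Commute.one_right _

/-- The matrix `R_{c,j}(v)`, where `c` is the last site. -/
def auxLeft (L : ℕ) (η v : ℂ) (j : Fin (L + 1)) : ChainOp (L + 2) :=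
  onSites (Fin.last (L + 1)) j.castSucc (rMatrix η v)

/-- The matrix `R_{j,c}(w)`, where `c` is the last site. -/
def auxRight (L : ℕ) (η w : ℂ) (j : Fin (L + 1)) : ChainOp (L + 2) :=
  onSites j.castSucc (Fin.last (L + 1)) (rMatrix η w)

theorem auxLeft_mul_auxRight {L : ℕ} {η v : ℂ} (hv : Complex.sinh (v + η) ≠ 0)
    (hv' : Complex.sinh (-v + η) ≠ 0) (j : Fin (L + 1)) :
    auxLeft L η v j * auxRight L η (-v) j = 1 := by
  have hne : Fin.last (L + 1) ≠ j.castSucc := (Fin.castSucc_lt_last j).ne'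
  rw [auxLeft, auxRight, onSites_rMatrix_swap j.castSucc, ← onSites_mul hne,
    rMatrix_mul_neg hv hv', onSites_one]

/-- No two adjacent bonds belong to one layer, so only the gate at `j` meets the sites `j`, `j + 1`
and the last site. -/
theorem extLayer_zipper {L : ℕ} {η u v : ℂ} (hu : Complex.sinh (u + η) ≠ 0)
    (hv : Complex.sinh (v + η) ≠ 0) (huv : Complex.sinh (u - v + η) ≠ 0)
    {p : ℕ → Prop} [DecidablePred p] (hp : ∀ i, p i → ¬ p (i + 1)) {j : Fin L} (hj : p j) :
    auxLeft L η v j.castSucc * extLayer L η u p * auxRight L η (u - v) j.castSucc =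
      auxRight L η (u - v) j.succ * extLayer L η u p * auxLeft L η v j.succ := by
  have hjL := j.2
  have key : ∀ i : Fin L, i ≠ j → ∀ a b : Fin (L + 2), a ≠ b →
      ((a : ℕ) = j ∨ (a : ℕ) = j + 1 ∨ (a : ℕ) = L + 1) →
      ((b : ℕ) = j ∨ (b : ℕ) = j + 1 ∨ (b : ℕ) = L + 1) →
      ∀ g, Commute (onSites a b g) (if p i then extGate L η u i else 1) := by
    intro i hi a b hne ha hb g
    have hiL := i.2
    split_ifs with hpi
    · have h1 : (i : ℕ) + 1 ≠ j := fun h => hp _ hpi (h ▸ hj)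
      have h2 : (j : ℕ) + 1 ≠ i := fun h => hp _ hj (h ▸ hpi)
      have h3 : (i : ℕ) ≠ j := fun h => hi (Fin.ext h)
      apply onSites_commute hne <;> (rw [ne_eq, Fin.ext_iff]; simp; try omega)
    · exact Commute.one_right _
  unfold extLayer
  have hne : ∀ i : Fin (L + 1), Fin.last (L + 1) ≠ i.castSucc := fun i =>
    (Fin.castSucc_lt_last i).ne'
  apply list_ofFn_prod_zipper _ j
  · exact fun i hi => key i hi _ _ (hne _) (by simp) (by simp) _
  · exact fun i hi => key i hi _ _ (hne _).symm (by simp) (by simp) _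
  · exact fun i hi => key i hi _ _ (hne _) (by simp) (by simp) _
  · exact fun i hi => key i hi _ _ (hne _).symm (by simp) (by simp) _
  · rw [if_pos hj]
    refine yang_baxter (hne _) (hne _) ?_ hu hv huv
    rw [ne_eq, Fin.ext_iff]
    simp

/-! ### The product density matrix -/

theorem rho_eq_diagonal (q : ℂ) :
    rho q = Matrix.diagonal fun i : Fin 2 => (q + q⁻¹)⁻¹ * (![q, q⁻¹] : Fin 2 → ℂ) i := by
  rw [rho, ← Matrix.diagonal_smul]
  rfl

theorem rhoBath_eq_diagonal (L : ℕ) (q : ℂ) :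
    rhoBath L q = Matrix.diagonal fun σ => ∏ j, rho q (σ j) (σ j) := by
  ext σ τ
  rw [Matrix.diagonal_apply]
  split_ifs with h
  · rw [h, rhoBath]
  · obtain ⟨j, hj⟩ := Function.ne_iff.1 h
    rw [rhoBath]
    refine Finset.prod_eq_zero (Finset.mem_univ j) ?_
    rw [rho_eq_diagonal, Matrix.diagonal_apply_ne _ hj]

/-- A nonzero entry joins configurations that are equal or differ by exchanging `a` and `b`; the
diagonal product weight is the same on both. -/
theorem onSites_commute_rhoBath {L : ℕ} {a b : Fin L} {g : PairOp}
    (hg : ConservesCharge g) (q : ℂ) : Commute (onSites a b g) (rhoBath L q) := by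
  rw [Commute, SemiconjBy, rhoBath_eq_diagonal]
  ext σ τ
  rw [Matrix.mul_diagonal, Matrix.diagonal_mul, mul_comm]
  by_cases h0 : onSites a b g σ τ = 0
  · simp [h0]
  congr 1
  simp only [onSites] at h0
  split_ifs at h0 with h
  · rcases hg _ _ h0 with h1 | h1
    · rw [Prod.mk.injEq] at h1
      refine Finset.prod_congr rfl fun k _ => ?_
      by_cases ha : k = a
      · rw [ha, h1.1]
      by_cases hb : k = b
      · rw [hb, h1.2]
      rw [h k ha hb]
    · rw [Prod.swap_prod_mk, Prod.mk.injEq] at h1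
      refine Fintype.prod_equiv (Equiv.swap a b) _ _ fun k => ?_
      by_cases ha : k = a
      · rw [ha, Equiv.swap_apply_left, h1.2]
      by_cases hb : k = b
      · rw [hb, Equiv.swap_apply_right, h1.1]
      rw [Equiv.swap_apply_of_ne_of_ne ha hb, h k ha hb]
  · exact absurd rfl h0

theorem trace_rho {q : ℂ} (hq' : q + q⁻¹ ≠ 0) : (rho q).trace = 1 := by
  simp [rho, inv_mul_cancel₀ hq']

/-! ### Tensoring with one more site -/

/-- The operator `Y ⊗ X`, where `X` acts on the last site. -/
def tensorLast {L : ℕ} (Y : ChainOp L) (X : Matrix (Fin 2) (Fin 2) ℂ) : ChainOp (L + 1) :=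
  fun σ τ => Y (Fin.init σ) (Fin.init τ) * X (σ (Fin.last L)) (τ (Fin.last L))

theorem sum_snoc {L : ℕ} (F : (Fin (L + 1) → Fin 2) → ℂ) :
    ∑ μ, F μ = ∑ ν : Fin L → Fin 2, ∑ r : Fin 2, F (Fin.snoc ν r) := by
  rw [Finset.sum_comm, ← Fintype.sum_prod_type']
  exact (Fintype.sum_equiv (Fin.snocEquiv fun _ => Fin 2) _ _ fun x => rfl).symm

theorem tensorLast_mul {L : ℕ} (Y Y' : ChainOp L) (X X' : Matrix (Fin 2) (Fin 2) ℂ) :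
    tensorLast Y X * tensorLast Y' X' = tensorLast (Y * Y') (X * X') := by
  ext σ τ
  simp only [tensorLast, Matrix.mul_apply, sum_snoc, Fin.init_snoc, Fin.snoc_last,
    Finset.sum_mul_sum]
  exact Finset.sum_congr rfl fun _ _ => Finset.sum_congr rfl fun _ _ => by ring

theorem trace_tensorLast {L : ℕ} (Y : ChainOp L) (X : Matrix (Fin 2) (Fin 2) ℂ) :
    (tensorLast Y X).trace = Y.trace * X.trace := by
  simp only [tensorLast, Matrix.trace, Matrix.diag, sum_snoc, Fin.init_snoc, Fin.snoc_last,
    Finset.sum_mul_sum]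

theorem rhoBath_succ (L : ℕ) (q : ℂ) : rhoBath (L + 1) q = tensorLast (rhoBath L q) (rho q) := by
  ext σ τ
  simp only [rhoBath, tensorLast, Fin.prod_univ_castSucc]
  rfl

theorem embedSites_castSucc {L : ℕ} (Y : ChainOp L) :
    embedSites Fin.castSucc Y = tensorLast Y 1 := by
  ext σ τ
  have h1 : (∀ k : Fin (L + 1), (∀ i : Fin L, i.castSucc ≠ k) → σ k = τ k) ↔
      σ (Fin.last L) = τ (Fin.last L) := by
    constructor
    · exact fun h => h _ fun i => (Fin.castSucc_lt_last i).ne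
    · intro h k
      refine Fin.lastCases (fun _ => h) (fun i hi => absurd rfl (hi i)) k
  simp only [embedSites, tensorLast, Matrix.one_apply, mul_ite, mul_one, mul_zero]
  exact if_congr h1 rfl rfl

theorem init_cons {L : ℕ} (a : Fin 2) (σ : Fin (L + 1) → Fin 2) :
    Fin.init (Fin.cons a σ : Fin (L + 2) → Fin 2) = Fin.cons a (Fin.init σ) := by
  funext i
  refine Fin.cases rfl (fun i => rfl) i

theorem boundaryElem_tensorLast {L : ℕ} (Y : ChainOp (L + 1)) (X : Matrix (Fin 2) (Fin 2) ℂ)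
    (a b : Fin 2) : boundaryElem (tensorLast Y X) a b = tensorLast (boundaryElem Y a b) X := by
  ext σ τ
  simp only [boundaryElem, tensorLast, init_cons]
  rfl

theorem inv_embedSites {m n : ℕ} {f : Fin m → Fin n} (hf : Function.Injective f) {M : ChainOp m}
    (hM : IsUnit M) : (embedSites f M)⁻¹ = embedSites f M⁻¹ :=
  Matrix.inv_eq_right_inv (by rw [← embedSites_mul hf, mul_inv_of_isUnit hM, embedSites_one])

theorem pathOp_embedSites_castSucc {L : ℕ} {M : ChainOp (L + 1)} (hM : IsUnit M) (n : ℕ)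
    (p : Fin n → TimeStep) :
    pathOp (embedSites Fin.castSucc M) n p = embedSites Fin.castSucc (pathOp M n p) := by
  unfold pathOp
  rw [inv_embedSites (Fin.castSucc_injective _) hM]
  simp only [embedSites_castSucc, boundaryElem_tensorLast]
  simp only [← embedSites_castSucc]
  exact (map_nestedProd (embedHom (Fin.castSucc_injective L)) _ _ n p).symm

/-- An uncoupled last spin factors out of the trace and contributes tr ρ(q) = 1. -/
theorem influence_embedSites_castSucc {L : ℕ} {q : ℂ} (hq' : q + q⁻¹ ≠ 0) {M : ChainOp (L + 1)}
    (hM : IsUnit M) (n : ℕ) (p : Fin n → TimeStep) :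
    influence (rhoBath (L + 1) q) (embedSites Fin.castSucc M) n p =
      influence (rhoBath L q) M n p := by
  rw [influence, pathOp_embedSites_castSucc hM, embedSites_castSucc, rhoBath_succ, tensorLast_mul,
    trace_tensorLast, mul_one, trace_rho hq', mul_one, influence]

/-! ### Independence of the length of the bath -/

theorem isUnit_layer {L : ℕ} {η u : ℂ} (hu : Complex.sinh (u + η) ≠ 0)
    (hu' : Complex.sinh (-u + η) ≠ 0) (p : ℕ → Prop) [DecidablePred p] :
    IsUnit (List.ofFn fun j : Fin L =>
      if p j then onSites j.succ j.castSucc (gate η u) else 1).prod := by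
  refine isUnit_list_prod fun x hx => ?_
  obtain ⟨j, rfl⟩ := (List.mem_ofFn' _ _).1 hx
  dsimp only
  split_ifs
  · exact isUnit_onSites (Fin.castSucc_lt_succ).ne' (gate_mul_gate_neg hu hu')
  · exact isUnit_one

theorem isUnit_floquet {L : ℕ} {η u : ℂ} (hu : Complex.sinh (u + η) ≠ 0)
    (hu' : Complex.sinh (-u + η) ≠ 0) : IsUnit (floquet L η u) :=
  (isUnit_layer hu hu' _).mul (isUnit_layer hu hu' _)

/-- Inserting a two-spin operator at the far end of the bath, between the two layers, does not
change the influence functional. -/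
theorem influence_far_insertion {N L : ℕ} (hL : 2 * N ≤ L) {η u q : ℂ} (hq' : q + q⁻¹ ≠ 0)
    (hu : Complex.sinh (u + η) ≠ 0) (hu' : Complex.sinh (-u + η) ≠ 0) {a b : Fin (L + 2)}
    (ha : L ≤ (a : ℕ)) (hb : L ≤ (b : ℕ)) (hab : a ≠ b) {g g' : PairOp} (hg : g * g' = 1)
    (p : Fin N → TimeStep) :
    influence (rhoBath (L + 1) q) (extLayer L η u (fun j => Odd j) * onSites a b g *
      extLayer L η u (fun j => Even j)) N p =
      influence (rhoBath L q) (floquet L η u) N p := by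
  rw [influence_eq_of_far, ← embedSites_floquet,
    influence_embedSites_castSucc hq' (isUnit_floquet hu hu')]
  · exact isUnit_onSites hab hg
  · exact fun d X hX => hX.conj_bondGates _ _ (isBondGate_extGate hu hu' _)
  · exact fun d X hX => hX.conj_bondGates _ _ (isBondGate_extGate hu hu' _)
  · exact fun X hX => hX a b (hL.trans ha) (hL.trans hb) hab g

theorem layer_succ (L : ℕ) (η u : ℂ) (p : ℕ → Prop) [DecidablePred p] :
    (List.ofFn fun j : Fin (L + 1) =>
      if p j then onSites j.succ j.castSucc (gate η u) else 1).prod =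
      extLayer L η u p *
        if p L then onSites (Fin.last (L + 1)) (Fin.last L).castSucc (gate η u) else 1 := by
  rw [List.ofFn_succ', List.concat_eq_append, List.prod_append, List.prod_singleton]
  simp only [Fin.val_last, Fin.succ_last]
  rfl

/-- Whichever layer the new bond belongs to, its gate can be placed between the layers: if `L` is
even, it commutes past the other gates of its own layer. In this position it is a far insertion. -/
theorem floquet_succ (L : ℕ) (η u : ℂ) :
    floquet (L + 1) η u = extLayer L η u (fun j => Odd j) *
      onSites (Fin.last (L + 1)) (Fin.last L).castSucc (gate η u) *
        extLayer L η u (fun j => Even j) := by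
  have he : evenLayer (L + 1) η u = _ := layer_succ L η u (fun j => Odd j)
  have ho : oddLayer (L + 1) η u = _ := layer_succ L η u (fun j => Even j)
  rw [floquet, he, ho]
  by_cases h : Even L
  · rw [if_neg (Nat.not_odd_iff_even.2 h), if_pos h, mul_one, mul_assoc]
    congr 1
    refine (extLayer_commute (Fin.castSucc_lt_last _).ne' ?_ _).eq.symm
    intro j hj hjL
    have : j + 1 ≠ L := by
      rintro rfl
      exact Nat.not_odd_iff_even.2 h hj.add_one
    simp
    omega
  · rw [if_pos (Nat.not_even_iff_odd.1 h), if_neg h, mul_one]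

theorem influence_floquet_succ {N L : ℕ} (hL : 2 * N ≤ L) {η u q : ℂ} (hq' : q + q⁻¹ ≠ 0)
    (hu : Complex.sinh (u + η) ≠ 0) (hu' : Complex.sinh (-u + η) ≠ 0) (p : Fin N → TimeStep) :
    influence (rhoBath (L + 1) q) (floquet (L + 1) η u) N p =
      influence (rhoBath L q) (floquet L η u) N p := by
  rw [floquet_succ]
  exact influence_far_insertion hL hq' hu hu' (by simp) (by simp) (Fin.castSucc_lt_last _).ne'
    (gate_mul_gate_neg hu hu') p

theorem influenceMatrix_eq_influence (N L : ℕ) (η u q : ℂ) (s t : Fin (2 * N) → Fin 2) :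
    influenceMatrix N L η u q s t =
      influence (rhoBath L q) (floquet L η u) N fun k =>
        ((s ⟨2 * (k : ℕ), by omega⟩, s ⟨2 * (k : ℕ) + 1, by omega⟩),
          (t ⟨2 * (k : ℕ) + 1, by omega⟩, t ⟨2 * (k : ℕ), by omega⟩)) := by
  rw [influenceMatrix, influence, pathOp, nestedProd_eq, mul_assoc, Matrix.trace_mul_comm,
    mul_assoc]
  rfl

/-- The boundary trajectories encoded by a state of the `4N` temporal sites. -/
def timeSteps (N : ℕ) (w : Fin (4 * N) → Fin 2) (k : Fin N) : TimeStep :=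
  ((w ⟨2 * N + 2 * (k : ℕ), by omega⟩, w ⟨2 * N + (2 * (k : ℕ) + 1), by omega⟩),
    (w ⟨2 * N - 1 - (2 * (k : ℕ) + 1), by omega⟩, w ⟨2 * N - 1 - 2 * (k : ℕ), by omega⟩))

theorem influenceVector_eq_influence (N L : ℕ) (η u q : ℂ) (w : Fin (4 * N) → Fin 2) :
    influenceVector N L η u q w =
      influence (rhoBath L q) (floquet L η u) N (timeSteps N w) :=
  influenceMatrix_eq_influence N L η u q _ _

theorem influenceVector_eq {N L : ℕ} (hL : 2 * N ≤ L) {η u q : ℂ} (hq' : q + q⁻¹ ≠ 0)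
    (hu : Complex.sinh (u + η) ≠ 0) (hu' : Complex.sinh (-u + η) ≠ 0) :
    influenceVector N L η u q = influenceVector N (2 * N) η u q := by
  induction L, hL using Nat.le_induction with
  | base => rfl
  | succ L hL ih =>
    rw [← ih]
    funext w
    rw [influenceVector_eq_influence, influenceVector_eq_influence,
      influence_floquet_succ hL hq' hu hu']

/-! ### Moving a spectral line through the bath -/

theorem lift_auxLeft {L : ℕ} (η v : ℂ) (j : Fin L) :
    auxLeft L η v j.succ = embedSites Fin.succ (onSites (Fin.last L) j.castSucc (rMatrix η v)) := by
  rw [embedSites_onSites (Fin.succ_injective _)]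
  rfl

theorem lift_auxRight {L : ℕ} (η v : ℂ) (j : Fin L) :
    auxRight L η v j.succ =
      embedSites Fin.succ (onSites j.castSucc (Fin.last L) (rMatrix η v)) := by
  rw [embedSites_onSites (Fin.succ_injective _)]
  rfl

theorem mul_zipper_zipper {M : Type*} [Monoid M] {a b b₁ a₂ x x' y y' E O : M}
    (h₀ : a * (O * b) = b₁ * (O * x)) (h₁ : x * (E * b₁) = y * (E * a₂)) (hx : x * x' = 1)
    (hy : y' * y = 1) :
    y' * (x * (E * (a * (O * (b * (x' * y)))))) = E * (a₂ * (O * y)) :=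
  calc y' * (x * (E * (a * (O * (b * (x' * y))))))
      = y' * (x * (E * (a * (O * b)))) * (x' * y) := by simp only [mul_assoc]
    _ = y' * (x * (E * b₁)) * O * (x * x') * y := by rw [h₀]; simp only [mul_assoc]
    _ = (y' * y) * E * a₂ * O * (x * x') * y := by rw [h₁]; simp only [mul_assoc]
    _ = E * (a₂ * (O * y)) := by rw [hx, hy]; simp only [mul_assoc, one_mul]

/-- The zipper through `Even` moves the line from site 2j to 2j + 1, leaving an R-matrix on the
wrong side of each layer. Conjugation by `y' * x`, which avoids the boundary spin, brings `x` round
to the left for the zipper through `Odd`, and then `y` to the right. -/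
theorem influence_line_step {N L : ℕ} {η u v q : ℂ}
    (hu : Complex.sinh (u + η) ≠ 0)
    (hv : Complex.sinh (v + η) ≠ 0) (hv' : Complex.sinh (-v + η) ≠ 0)
    (huv : Complex.sinh (u - v + η) ≠ 0) (huv' : Complex.sinh (v - u + η) ≠ 0)
    (j : ℕ) (hjL : 2 * j + 2 ≤ L) (p : Fin N → TimeStep) :
    influence (rhoBath (L + 1) q)
      (extLayer L η u (fun j => Odd j) * auxLeft L η v ⟨2 * j, by omega⟩ *
        extLayer L η u (fun j => Even j) * auxRight L η (u - v) ⟨2 * j, by omega⟩) N p =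
    influence (rhoBath (L + 1) q)
      (extLayer L η u (fun j => Odd j) * auxLeft L η v ⟨2 * j + 2, by omega⟩ *
        extLayer L η u (fun j => Even j) * auxRight L η (u - v) ⟨2 * j + 2, by omega⟩) N p := by
  let j₀ : Fin L := ⟨2 * j, by omega⟩
  let j₁ : Fin L := ⟨2 * j + 1, by omega⟩
  have z₀ := extLayer_zipper hu hv huv (p := fun j => Even j)
    (fun i hi => Nat.not_even_iff_odd.2 hi.add_one) (j := j₀) (even_two_mul j)
  have z₁ := extLayer_zipper hu hv huv (p := fun j => Odd j)
    (fun i hi => Nat.not_odd_iff_even.2 hi.add_one) (j := j₁) ⟨j, rfl⟩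
  have hvu : Complex.sinh (-(u - v) + η) ≠ 0 := by rwa [neg_sub]
  have hne : ∀ i : Fin L, Fin.last L ≠ i.castSucc := fun i => (Fin.castSucc_lt_last i).ne'
  set x := onSites (Fin.last L) j₀.castSucc (rMatrix η v) with hx
  set x' := onSites (Fin.last L) j₀.castSucc (rMatrix η (-v)) with hx'
  set y := onSites j₁.castSucc (Fin.last L) (rMatrix η (u - v)) with hy
  set y' := onSites j₁.castSucc (Fin.last L) (rMatrix η (-(u - v))) with hy'
  have xx' : x * x' = 1 := by rw [hx, hx', ← onSites_mul (hne _), rMatrix_mul_neg hv hv', onSites_one]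
  have yy' : y * y' = 1 := by
    rw [hy, hy', ← onSites_mul (hne _).symm, rMatrix_mul_neg huv hvu, onSites_one]
  have x'x : x' * x = 1 := mul_eq_one_comm.1 xx'
  have y'y : y' * y = 1 := mul_eq_one_comm.1 yy'
  have hA : y' * x * (x' * y) = 1 := by rw [mul_assoc, ← mul_assoc x, xx', one_mul, y'y]
  have hA' : x' * y * (y' * x) = 1 := by rw [mul_assoc, ← mul_assoc y, yy', one_mul, x'x]
  have hρ : Commute (y' * x) (rhoBath (L + 1) q) :=
    (onSites_commute_rhoBath (conservesCharge_rMatrix _ _) q).mul_left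
      (onSites_commute_rhoBath (conservesCharge_rMatrix _ _) q)
  rw [← influence_conj hA hA' hρ]
  congr 1
  have ex : auxLeft L η v j₁.castSucc = embedSites Fin.succ x := lift_auxLeft η v j₀
  have ey : auxRight L η (u - v) j₁.succ = embedSites Fin.succ y := lift_auxRight η (u - v) j₁
  have ex' : embedSites Fin.succ x * embedSites Fin.succ x' = 1 := by
    rw [← embedSites_mul (Fin.succ_injective _), xx', embedSites_one]
  have ey' : embedSites Fin.succ y' * embedSites Fin.succ y = 1 := by
    rw [← embedSites_mul (Fin.succ_injective _), y'y, embedSites_one]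
  change _ * (_ * auxLeft L η v j₀.castSucc * _ * auxRight L η (u - v) j₀.castSucc) * _ =
    _ * auxLeft L η v j₁.succ * _ * auxRight L η (u - v) j₁.succ
  have ej : j₀.succ = j₁.castSucc := rfl
  rw [ej, ex] at z₀
  rw [ex, ey] at z₁
  rw [ey, embedSites_mul (Fin.succ_injective _), embedSites_mul (Fin.succ_injective _)]
  simp only [mul_assoc] at z₀ z₁ ⊢
  exact mul_zipper_zipper z₀ z₁ ex' ey'

/-- The coupling `R_{c,0}(v) U⁺ R_{0,c}(u-v)` of the boundary spin to the bath and to an additional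
spin `c` at the far end of the chain. -/
def dressedFloquet (L : ℕ) (η u v : ℂ) : ChainOp (L + 2) :=
  auxLeft L η v 0 * embedSites Fin.castSucc (floquet L η u) * auxRight L η (u - v) 0

theorem influence_dressedFloquet {N : ℕ} {η u v q : ℂ} (hq' : q + q⁻¹ ≠ 0)
    (hu : Complex.sinh (u + η) ≠ 0) (hu' : Complex.sinh (-u + η) ≠ 0)
    (hv : Complex.sinh (v + η) ≠ 0) (hv' : Complex.sinh (-v + η) ≠ 0)
    (huv : Complex.sinh (u - v + η) ≠ 0) (huv' : Complex.sinh (v - u + η) ≠ 0)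
    (p : Fin N → TimeStep) :
    influence (rhoBath (2 * N + 1) q) (dressedFloquet (2 * N) η u v) N p =
      influence (rhoBath (2 * N) q) (floquet (2 * N) η u) N p := by
  have hvu : Complex.sinh (-(u - v) + η) ≠ 0 := by rwa [neg_sub]
  have hne : ∀ i : Fin (2 * N + 1), Fin.last (2 * N + 1) ≠ i.castSucc := fun i =>
    (Fin.castSucc_lt_last i).ne'
  have steps : ∀ j (hj : j ≤ N), influence (rhoBath (2 * N + 1) q)
      (dressedFloquet (2 * N) η u v) N p = influence (rhoBath (2 * N + 1) q)
      (extLayer (2 * N) η u (fun j => Odd j) * auxLeft (2 * N) η v ⟨2 * j, by omega⟩ *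
        extLayer (2 * N) η u (fun j => Even j) *
          auxRight (2 * N) η (u - v) ⟨2 * j, by omega⟩) N p := by
    intro j
    induction j with
    | zero =>
      intro _
      -- Odd bonds do not touch site 0, so the left R-matrix can be brought between the layers.
      have hc : Commute (auxLeft (2 * N) η v 0) (extLayer (2 * N) η u fun j => Odd j) := by
        refine extLayer_commute (hne 0) (fun j hj hjN => ?_) _
        have := hj.pos
        simp
        omega
      rw [dressedFloquet, embedSites_floquet, ← mul_assoc, hc.eq]
      rfl
    | succ j ih =>
      intro hj
      rw [ih (by omega), influence_line_step hu hv hv' huv huv' j (by omega)]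
      rfl
  -- Even bonds below 2N do not reach site 2N, so both R-matrices merge into one far insertion
  -- between the layers.
  have hc : Commute (auxRight (2 * N) η (u - v) (Fin.last (2 * N)))
      (extLayer (2 * N) η u fun j => Even j) := by
    refine extLayer_commute (hne _).symm (fun j hj hjN => ?_) _
    obtain ⟨k, rfl⟩ := hj
    simp
    omega
  have hg : rMatrix η v * rMatrix η (u - v) * (rMatrix η (-(u - v)) * rMatrix η (-v)) = 1 := by
    rw [mul_assoc, ← mul_assoc (rMatrix η (u - v)), rMatrix_mul_neg huv hvu, one_mul,
      rMatrix_mul_neg hv hv']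
  rw [steps N le_rfl, ← influence_far_insertion le_rfl hq' hu hu' (a := Fin.last (2 * N + 1))
    (b := (Fin.last (2 * N)).castSucc) (by simp) (by simp) (hne _) hg p, onSites_mul (hne _),
    onSites_rMatrix_swap (Fin.last (2 * N + 1)) _ η (u - v)]
  change influence _ (_ * auxLeft (2 * N) η v (Fin.last (2 * N)) * _ *
    auxRight (2 * N) η (u - v) (Fin.last (2 * N))) N p = influence _ (_ *
      (auxLeft (2 * N) η v (Fin.last (2 * N)) * auxRight (2 * N) η (u - v) (Fin.last (2 * N))) * _)
      N p
  simp only [mul_assoc]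
  rw [hc.eq]

/-! ### Nonvanishing -/

/-- Once the inner steps have summed to 1, the sum over `r` at the outer step gives ⟨0|M M⁻¹|0⟩ = 1.
-/
theorem sum_pathOp_diagonal {L : ℕ} {M : ChainOp (L + 1)} (hM : IsUnit M) (n : ℕ) :
    ∑ r : Fin n → Fin 2, pathOp M n (fun k => ((0, r k), (r k, 0))) = 1 := by
  induction n with
  | zero => simp [pathOp, nestedProd]
  | succ n ih =>
    have h : ∀ x : Fin 2 × (Fin n → Fin 2),
        pathOp M (n + 1) (fun k => ((0, (Fin.cons x.1 x.2 : Fin (n + 1) → Fin 2) k),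
          ((Fin.cons x.1 x.2 : Fin (n + 1) → Fin 2) k, 0))) =
        boundaryElem M 0 x.1 * pathOp M n (fun k => ((0, x.2 k), (x.2 k, 0))) *
          boundaryElem M⁻¹ x.1 0 := fun x => rfl
    rw [← Fintype.sum_equiv (Fin.consEquiv fun _ => Fin 2) _ _ fun x => (h x).symm,
      Fintype.sum_prod_type]
    simp only [← Finset.sum_mul, ← Finset.mul_sum, ih, mul_one]
    rw [← boundaryElem_mul, mul_inv_of_isUnit hM, boundaryElem_one, if_pos rfl]

theorem trace_rhoBath (L : ℕ) {q : ℂ} (hq' : q + q⁻¹ ≠ 0) : (rhoBath L q).trace = 1 := by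
  induction L with
  | zero => simp [rhoBath, Matrix.trace]
  | succ L ih => rw [rhoBath_succ, trace_tensorLast, ih, trace_rho hq', one_mul]

theorem exists_influence_ne_zero {L : ℕ} {q : ℂ} (hq' : q + q⁻¹ ≠ 0) {M : ChainOp (L + 1)}
    (hM : IsUnit M) (n : ℕ) : ∃ p, influence (rhoBath L q) M n p ≠ 0 := by
  by_contra! h
  have h1 := congrArg (fun X => (rhoBath L q * X).trace) (sum_pathOp_diagonal hM n)
  simp only [Finset.mul_sum, Matrix.trace_sum, mul_one, trace_rhoBath L hq'] at h1
  refine zero_ne_one (α := ℂ) (Eq.trans (Finset.sum_eq_zero fun r _ => ?_).symm h1)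
  exact h _

/-! ### Expansion of nested products -/

theorem nestedProd_sum {α β γ R : Type*} [Fintype β] [Fintype γ] [Semiring R]
    (F : α → β → R) (B : α → γ → R) (n : ℕ) (p : Fin n → α) :
    nestedProd (fun a => ∑ b, F a b) (fun a => ∑ c, B a c) n p =
      ∑ p' : Fin n → β × γ, nestedProd (fun x : α × (β × γ) => F x.1 x.2.1)
        (fun x => B x.1 x.2.2) n (fun k => (p k, p' k)) := by
  induction n with
  | zero => simp [nestedProd]
  | succ n ih =>
    refine Eq.trans ?_ (Fintype.sum_equiv (Fin.consEquiv fun _ : Fin (n + 1) => β × γ)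
      (fun x => F (p 0) x.1.1 * nestedProd (fun x : α × (β × γ) => F x.1 x.2.1)
        (fun x => B x.1 x.2.2) n (fun k => (Fin.tail p k, x.2 k)) * B (p 0) x.1.2) _ fun x => rfl)
    rw [Fintype.sum_prod_type, nestedProd, ih]
    simp only [← Finset.mul_sum, ← Finset.sum_mul, Fintype.sum_prod_type]

theorem tensorLast_one (L : ℕ) : tensorLast (1 : ChainOp L) 1 = 1 := by
  rw [← embedSites_castSucc, embedSites_one]

theorem nestedProd_tensorLast {α : Type*} {L : ℕ} (F B : α → ChainOp L)
    (F' B' : α → Matrix (Fin 2) (Fin 2) ℂ) (n : ℕ) (p : Fin n → α) :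
    nestedProd (fun a => tensorLast (F a) (F' a)) (fun a => tensorLast (B a) (B' a)) n p =
      tensorLast (nestedProd F B n p) (nestedProd F' B' n p) := by
  induction n with
  | zero => exact (tensorLast_one L).symm
  | succ n ih => simp only [nestedProd, ih, tensorLast_mul]

theorem nestedProd_comp {α β M : Type*} [Monoid M] (F B : β → M) (φ : α → β) (n : ℕ)
    (p : Fin n → α) :
    nestedProd (fun a => F (φ a)) (fun a => B (φ a)) n p = nestedProd F B n (fun k => φ (p k)) := by
  induction n with
  | zero => rfl
  | succ n ih => simp only [nestedProd, ih]; rfl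

/-! ### The dressed coupling -/

/-- The matrix element of `R(v)` between states `a`, `b` of the second factor. -/
def auxMat (η v : ℂ) (a b : Fin 2) : Matrix (Fin 2) (Fin 2) ℂ :=
  fun x y => rMatrix η v (x, a) (y, b)

theorem boundaryElem_auxLeft (L : ℕ) (η v : ℂ) (a b : Fin 2) :
    boundaryElem (auxLeft L η v 0) a b = tensorLast 1 (auxMat η v a b) := by
  ext σ τ
  have h1 : (∀ k : Fin (L + 2), k ≠ Fin.last (L + 1) → k ≠ (0 : Fin (L + 1)).castSucc →
      (Fin.cons a σ : Fin (L + 2) → Fin 2) k = (Fin.cons b τ : Fin (L + 2) → Fin 2) k) ↔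
      Fin.init σ = Fin.init τ := by
    constructor
    · intro h
      funext i
      refine h i.castSucc.succ (fun h' => ?_) (Fin.succ_ne_zero _)
      rw [Fin.succ_castSucc] at h'
      exact (Fin.castSucc_lt_last _).ne h'
    · intro h k
      refine Fin.cases (fun _ h0 => absurd rfl h0) (fun i => ?_) k
      refine Fin.lastCases (fun hl => absurd (Fin.succ_last L) hl) (fun i _ _ => ?_) i
      exact congrFun h i
  simp only [boundaryElem, auxLeft, onSites, tensorLast, Matrix.one_apply, ite_mul, one_mul,
    zero_mul]
  exact if_congr h1 rfl rfl

theorem boundaryElem_auxRight (L : ℕ) (η v : ℂ) (a b : Fin 2) :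
    boundaryElem (auxRight L η v 0) a b = tensorLast 1 (auxMat η v a b) := by
  rw [← boundaryElem_auxLeft, auxLeft, auxRight, onSites_rMatrix_swap]

theorem boundaryElem_dressed {L : ℕ} (η v v' : ℂ) (M : ChainOp (L + 1)) (a b : Fin 2) :
    boundaryElem (auxLeft L η v 0 * embedSites Fin.castSucc M * auxRight L η v' 0) a b =
      ∑ r : Fin 2 × Fin 2, tensorLast (boundaryElem M r.1 r.2)
        (auxMat η v a r.1 * auxMat η v' r.2 b) := by
  simp only [boundaryElem_mul, boundaryElem_auxLeft, boundaryElem_auxRight, embedSites_castSucc,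
    boundaryElem_tensorLast, tensorLast_mul, one_mul, mul_one, Finset.sum_mul,
    Fintype.sum_prod_type]
  exact Finset.sum_comm

theorem inv_dressedFloquet {L : ℕ} {η u v : ℂ}
    (hu : Complex.sinh (u + η) ≠ 0) (hu' : Complex.sinh (-u + η) ≠ 0)
    (hv : Complex.sinh (v + η) ≠ 0) (hv' : Complex.sinh (-v + η) ≠ 0)
    (huv : Complex.sinh (u - v + η) ≠ 0) (huv' : Complex.sinh (v - u + η) ≠ 0) :
    (dressedFloquet L η u v)⁻¹ =
      auxLeft L η (v - u) 0 * embedSites Fin.castSucc (floquet L η u)⁻¹ *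
        auxRight L η (-v) 0 := by
  have h1 : auxLeft L η (v - u) 0 * auxRight L η (u - v) 0 = 1 := by
    have := auxLeft_mul_auxRight (L := L) huv' (by rwa [neg_sub]) 0
    rwa [neg_sub] at this
  rw [dressedFloquet, Matrix.mul_inv_rev, Matrix.mul_inv_rev, Matrix.inv_eq_left_inv h1,
    Matrix.inv_eq_right_inv (auxLeft_mul_auxRight hv hv' 0),
    inv_embedSites (Fin.castSucc_injective _) (isUnit_floquet hu hu'), mul_assoc]

/-- The product of auxiliary matrices between two sequences of boundary states. -/
def auxPath (η u v : ℂ) (n : ℕ) (p p' : Fin n → TimeStep) : Matrix (Fin 2) (Fin 2) ℂ :=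
  nestedProd
    (fun x : TimeStep × TimeStep =>
      auxMat η v x.1.1.1 x.2.1.1 * auxMat η (u - v) x.2.1.2 x.1.1.2)
    (fun x => auxMat η (v - u) x.1.2.1 x.2.2.1 * auxMat η (-v) x.2.2.2 x.1.2.2) n
    (fun k => (p k, p' k))

/-- At fixed inner boundary states `p'` the path operator is a tensor product: the bare bath on one
side, the added spin on the other. The trace therefore factorizes. -/
theorem influence_dressedFloquet_eq_sum {L : ℕ} {η u v q : ℂ}
    (hu : Complex.sinh (u + η) ≠ 0) (hu' : Complex.sinh (-u + η) ≠ 0)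
    (hv : Complex.sinh (v + η) ≠ 0) (hv' : Complex.sinh (-v + η) ≠ 0)
    (huv : Complex.sinh (u - v + η) ≠ 0) (huv' : Complex.sinh (v - u + η) ≠ 0) (n : ℕ)
    (p : Fin n → TimeStep) :
    influence (rhoBath (L + 1) q) (dressedFloquet L η u v) n p =
      ∑ p', (rho q * auxPath η u v n p p').trace *
        influence (rhoBath L q) (floquet L η u) n p' := by
  have h : pathOp (dressedFloquet L η u v) n p =
      ∑ p', tensorLast (pathOp (floquet L η u) n p') (auxPath η u v n p p') := by
    unfold pathOp
    rw [inv_dressedFloquet hu hu' hv hv' huv huv']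
    simp only [dressedFloquet, boundaryElem_dressed]
    rw [nestedProd_sum]
    refine Finset.sum_congr rfl fun p' _ => ?_
    rw [nestedProd_tensorLast, auxPath]
    congr 1
    exact nestedProd_comp (fun a : TimeStep => boundaryElem (floquet L η u) a.1.1 a.1.2)
      (fun a => boundaryElem (floquet L η u)⁻¹ a.2.1 a.2.2) Prod.snd n fun k => (p k, p' k)
  rw [influence, h, Finset.mul_sum, Matrix.trace_sum]
  refine Finset.sum_congr rfl fun p' _ => ?_
  rw [rhoBath_succ, tensorLast_mul, trace_tensorLast, mul_comm, influence]

/-! ### The transfer matrix -/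

/-- Each temporal site is acted on at most once, so its state jumps from `w` to `w'` at its own
factor. All sums over temporal states collapse and a product of auxiliary matrices remains. The `0`
in `Fin.cons 0 w` is a placeholder that allows `k` to be the auxiliary site. -/
theorem list_prod_apply_of_local {n : ℕ} {O : Fin (n + 1) → ChainOp (n + 1)}
    {X : Fin (n + 1) → Fin 2 → Fin 2 → Matrix (Fin 2) (Fin 2) ℂ}
    (hO : ∀ k a b (w w' : Fin n → Fin 2), O k (Fin.cons a w) (Fin.cons b w') =
      if ∀ i : Fin n, i.succ ≠ k → w i = w' i then
        X k ((Fin.cons 0 w : Fin (n + 1) → Fin 2) k) ((Fin.cons 0 w' : Fin (n + 1) → Fin 2) k) a b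
      else 0)
    (l : List (Fin (n + 1))) (hl : l.Nodup) (a b : Fin 2) (w w' : Fin n → Fin 2) :
    (l.map O).prod (Fin.cons a w) (Fin.cons b w') =
      if ∀ i : Fin n, i.succ ∉ l → w i = w' i then
        (l.map fun k => X k ((Fin.cons 0 w : Fin (n + 1) → Fin 2) k)
          ((Fin.cons 0 w' : Fin (n + 1) → Fin 2) k)).prod a b
      else 0 := by
  induction l generalizing a w with
  | nil =>
    simp only [List.map_nil, List.prod_nil, Matrix.one_apply, List.not_mem_nil, not_false_eq_true,
      forall_const, Fin.cons_inj, ← funext_iff, ← ite_and]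
    exact if_congr and_comm rfl rfl
  | cons k l ih =>
    rw [List.nodup_cons] at hl
    rw [List.map_cons, List.prod_cons, Matrix.mul_apply, sum_cons]
    simp only [ih hl.2, hO]
    -- The only intermediate configuration that contributes: site `k` has jumped, the sites of `l`
    -- have not.
    let ν : Fin n → Fin 2 := fun i => if i.succ = k then w' i else w i
    have hν : ∀ c (μ : Fin n → Fin 2), μ ≠ ν →
        (if ∀ i : Fin n, i.succ ≠ k → w i = μ i then
          X k ((Fin.cons 0 w : Fin (n + 1) → Fin 2) k) ((Fin.cons 0 μ : Fin (n + 1) → Fin 2) k) a c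
          else 0) *
        (if ∀ i : Fin n, i.succ ∉ l → μ i = w' i then
          (l.map fun k => X k ((Fin.cons 0 μ : Fin (n + 1) → Fin 2) k)
            ((Fin.cons 0 w' : Fin (n + 1) → Fin 2) k)).prod c b else 0) = 0 := by
      intro c μ hμ
      by_contra hne
      obtain ⟨h1, h2⟩ := mul_ne_zero_iff.1 hne
      rw [ite_ne_right_iff] at h1 h2
      apply hμ
      funext i
      by_cases hi : i.succ = k
      · simp only [ν, if_pos hi]
        exact h2.1 i (hi ▸ hl.1)
      · simp only [ν, if_neg hi]
        exact (h1.1 i hi).symm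
    have e1 : ∀ i : Fin n, i.succ ≠ k → w i = ν i := fun i hi => by simp [ν, hi]
    have e2 : (Fin.cons 0 ν : Fin (n + 1) → Fin 2) k = (Fin.cons 0 w' : Fin (n + 1) → Fin 2) k := by
      refine Fin.cases (motive := fun k' => k = k' → _) (fun h => by simp [h])
        (fun i h => ?_) k rfl
      simp [h, ν]
    have e3 : ∀ j ∈ l, (Fin.cons 0 ν : Fin (n + 1) → Fin 2) j =
        (Fin.cons 0 w : Fin (n + 1) → Fin 2) j := by
      intro j
      refine Fin.cases (fun _ => rfl) (fun i hi => ?_) j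
      have : i.succ ≠ k := fun h => hl.1 (h ▸ hi)
      simp [ν, this]
    have e4 : (∀ i : Fin n, i.succ ∉ l → ν i = w' i) ↔
        ∀ i : Fin n, i.succ ∉ k :: l → w i = w' i := by
      refine forall_congr' fun i => ?_
      by_cases hi : i.succ = k
      · simp [hi, ν]
      · simp [hi, ν]
    have e5 : (l.map fun k => X k ((Fin.cons 0 ν : Fin (n + 1) → Fin 2) k)
          ((Fin.cons 0 w' : Fin (n + 1) → Fin 2) k)) =
        l.map fun k => X k ((Fin.cons 0 w : Fin (n + 1) → Fin 2) k)
          ((Fin.cons 0 w' : Fin (n + 1) → Fin 2) k) :=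
      List.map_congr_left fun j hj => by rw [e3 j hj]
    have hsum : ∀ c, _ := fun c => Finset.sum_eq_single (s := Finset.univ) ν
      (fun μ _ hμ => hν c μ hμ) (fun h => absurd (Finset.mem_univ _) h)
    simp only [hsum, if_pos e1, e2, e5, if_congr e4 rfl rfl, List.map_cons, List.prod_cons,
      Matrix.mul_apply]
    split_ifs <;> simp

/-- The transposed auxiliary matrix of the temporal site `k`. -/
def siteMat (N : ℕ) (η u v : ℂ) (k : ℕ) (x y : Fin 2) : Matrix (Fin 2) (Fin 2) ℂ :=
  if 2 * N < k then
    if Even k then auxMat η (u - v) y x else auxMat η v x y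
  else
    if Even k then auxMat η (-v) y x else auxMat η (v - u) x y

theorem rMatrix_swap_apply (η u : ℂ) (x y : Fin 2 × Fin 2) :
    rMatrix η u x y = rMatrix η u y.swap x.swap := by
  conv_lhs => rw [rMatrix_comm, ← swapOp_rMatrix]
  rfl

/-- The order `b a` is a transposition in the auxiliary space. It holds because R is symmetric and
invariant under exchange of its factors. -/
theorem siteFactor_apply (N : ℕ) (η u v : ℂ) (k : Fin (4 * N + 1)) (hk : k ≠ 0) (a b : Fin 2)
    (w w' : Fin (4 * N) → Fin 2) :
    siteFactor N η u v k (Fin.cons a w) (Fin.cons b w') =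
      if ∀ i : Fin (4 * N), i.succ ≠ k → w i = w' i then
        siteMat N η u v k ((Fin.cons 0 w : Fin (4 * N + 1) → Fin 2) k)
          ((Fin.cons 0 w' : Fin (4 * N + 1) → Fin 2) k) b a
      else 0 := by
  obtain ⟨k, rfl⟩ := Fin.exists_succ_eq.2 hk
  have e1 : (∀ j : Fin (4 * N + 1), j ≠ k.succ → j ≠ 0 →
      (Fin.cons a w : Fin (4 * N + 1) → Fin 2) j = (Fin.cons b w' : Fin (4 * N + 1) → Fin 2) j) ↔
      ∀ i : Fin (4 * N), i.succ ≠ k.succ → w i = w' i := by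
    refine ⟨fun h i hi => h i.succ hi (Fin.succ_ne_zero i), fun h j => ?_⟩
    exact Fin.cases (fun _ h0 => absurd rfl h0) (fun i hi _ => h i hi) j
  have e2 : (∀ j : Fin (4 * N + 1), j ≠ 0 → j ≠ k.succ →
      (Fin.cons a w : Fin (4 * N + 1) → Fin 2) j = (Fin.cons b w' : Fin (4 * N + 1) → Fin 2) j) ↔
      ∀ i : Fin (4 * N), i.succ ≠ k.succ → w i = w' i :=
    Iff.trans ⟨fun h j hj hj' => h j hj' hj, fun h j hj hj' => h j hj' hj⟩ e1
  unfold siteFactor siteMat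
  by_cases hc : ∀ i : Fin (4 * N), i.succ ≠ k.succ → w i = w' i
  · rw [if_pos hc]
    split_ifs <;>
      simp only [onSites, transposeSnd, auxMat, Fin.cons_zero, Fin.cons_succ, if_pos (e1.2 hc),
        if_pos (e2.2 hc)]
    · exact rMatrix_swap_apply _ _ _ _
    · exact rMatrix_comm _ _ _ _
    · exact rMatrix_swap_apply _ _ _ _
    · exact rMatrix_comm _ _ _ _
  · rw [if_neg hc]
    split_ifs <;> simp only [onSites, if_neg (mt e1.1 hc), if_neg (mt e2.1 hc)]

theorem monodromy_apply (N : ℕ) (η u q v : ℂ) (a b : Fin 2) (w w' : Fin (4 * N) → Fin 2) :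
    monodromy N η u q v (Fin.cons a w) (Fin.cons b w') =
      ((List.ofFn fun m : Fin (2 * N) => (siteMat N η u v (2 * N + 1 + (m : ℕ))
          (w ⟨2 * N + (m : ℕ), by omega⟩) (w' ⟨2 * N + (m : ℕ), by omega⟩))ᵀ).reverse.prod *
        rho q *
        (List.ofFn fun m : Fin (2 * N) => (siteMat N η u v (1 + (m : ℕ))
          (w ⟨(m : ℕ), by omega⟩) (w' ⟨(m : ℕ), by omega⟩))ᵀ).reverse.prod) a b := by
  let O : Fin (4 * N + 1) → ChainOp (4 * N + 1) := fun k =>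
    if k = 0 then onSite 0 (rho q) else siteFactor N η u v k
  let X : Fin (4 * N + 1) → Fin 2 → Fin 2 → Matrix (Fin 2) (Fin 2) ℂ := fun k x y =>
    if k = 0 then rho q else (siteMat N η u v k x y)ᵀ
  let upper : Fin (2 * N) → Fin (4 * N + 1) := fun m => ⟨2 * N + 1 + (m : ℕ), by omega⟩
  let lower : Fin (2 * N) → Fin (4 * N + 1) := fun m => ⟨1 + (m : ℕ), by omega⟩
  let l : List (Fin (4 * N + 1)) :=
    (List.ofFn upper).reverse ++ [0] ++ (List.ofFn lower).reverse
  have hupper : ∀ m, upper m = Fin.succ ⟨2 * N + (m : ℕ), by omega⟩ := fun m =>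
    Fin.ext (by simp [upper]; omega)
  have hlower : ∀ m, lower m = Fin.succ ⟨(m : ℕ), by omega⟩ := fun m =>
    Fin.ext (by simp [lower]; omega)
  have hO : ∀ k a b (w w' : Fin (4 * N) → Fin 2), O k (Fin.cons a w) (Fin.cons b w') =
      if ∀ i : Fin (4 * N), i.succ ≠ k → w i = w' i then
        X k ((Fin.cons 0 w : Fin (4 * N + 1) → Fin 2) k)
          ((Fin.cons 0 w' : Fin (4 * N + 1) → Fin 2) k) a b
      else 0 := by
    intro k a b w w'
    by_cases hk : k = 0
    · subst hk
      simp only [O, X, if_true, onSite]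
      refine if_congr ⟨fun h i _ => h i.succ (Fin.succ_ne_zero i), fun h j => ?_⟩ rfl rfl
      exact Fin.cases (fun h0 => absurd rfl h0) (fun i _ => h i (Fin.succ_ne_zero i)) j
    · simp only [O, X, if_neg hk]
      exact siteFactor_apply N η u v k hk a b w w'
  have hl : l.Nodup := by
    have h1 : Function.Injective upper := fun m m' h => by
      simpa [upper, Fin.ext_iff] using h
    have h2 : Function.Injective lower := fun m m' h => by
      simpa [lower, Fin.ext_iff] using h
    simp only [l, List.nodup_append', List.nodup_reverse, List.nodup_ofFn.2 h1,
      List.nodup_ofFn.2 h2, List.nodup_singleton, true_and, List.disjoint_left, List.mem_append,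
      List.mem_reverse, List.mem_ofFn', Set.mem_range, List.mem_singleton]
    refine ⟨?_, ?_⟩
    · rintro _ ⟨m, rfl⟩
      rw [hupper]
      exact Fin.succ_ne_zero _
    · rintro _ (⟨m, rfl⟩ | rfl) ⟨m', h⟩
      · have h3 := m'.2
        simp only [upper, lower, Fin.ext_iff] at h
        omega
      · rw [hlower] at h
        exact Fin.succ_ne_zero _ h
  have hmem : ∀ i : Fin (4 * N), i.succ ∈ l := by
    intro i
    simp only [l, List.mem_append, List.mem_reverse, List.mem_ofFn', Set.mem_range]
    by_cases hi : (i : ℕ) < 2 * N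
    · refine Or.inr ⟨⟨i, hi⟩, ?_⟩
      rw [hlower]
    · refine Or.inl (Or.inl ⟨⟨(i : ℕ) - 2 * N, by omega⟩, ?_⟩)
      rw [hupper, Fin.ext_iff]
      simp
      omega
  have key := list_prod_apply_of_local hO l hl a b w w'
  rw [if_pos fun i hi => absurd (hmem i) hi] at key
  have hOu : ∀ m, O (upper m) = siteFactor N η u v (upper m) := fun m => by
    simp only [O, hupper, if_neg (Fin.succ_ne_zero _)]
  have hOl : ∀ m, O (lower m) = siteFactor N η u v (lower m) := fun m => by
    simp only [O, hlower, if_neg (Fin.succ_ne_zero _)]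
  have hXu : ∀ m, X (upper m) ((Fin.cons 0 w : Fin (4 * N + 1) → Fin 2) (upper m))
      ((Fin.cons 0 w' : Fin (4 * N + 1) → Fin 2) (upper m)) =
      (siteMat N η u v (2 * N + 1 + (m : ℕ))
          (w ⟨2 * N + (m : ℕ), by omega⟩) (w' ⟨2 * N + (m : ℕ), by omega⟩))ᵀ := fun m => by
    have : (upper m : ℕ) = 2 * N + 1 + (m : ℕ) := rfl
    simp only [X, ← this]
    simp only [hupper, if_neg (Fin.succ_ne_zero _), Fin.cons_succ]
  have hXl : ∀ m, X (lower m) ((Fin.cons 0 w : Fin (4 * N + 1) → Fin 2) (lower m))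
      ((Fin.cons 0 w' : Fin (4 * N + 1) → Fin 2) (lower m)) =
      (siteMat N η u v (1 + (m : ℕ))
          (w ⟨(m : ℕ), by omega⟩) (w' ⟨(m : ℕ), by omega⟩))ᵀ := fun m => by
    have : (lower m : ℕ) = 1 + (m : ℕ) := rfl
    simp only [X, ← this]
    simp only [hlower, if_neg (Fin.succ_ne_zero _), Fin.cons_succ]
  have h0 : O 0 = onSite 0 (rho q) := if_pos rfl
  have h0' : ∀ x y, X 0 x y = rho q := fun x y => if_pos rfl
  simp only [l, List.map_append, List.map_reverse, List.map_ofFn, List.map_cons, List.map_nil,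
    List.prod_append, List.prod_singleton, Function.comp_def, hOu, hOl, hXu, hXl, h0, h0'] at key
  exact key

theorem prod_ofFn_pairs {M : Type*} [Monoid M] (f : ℕ → M) (N : ℕ) :
    (List.ofFn fun m : Fin (2 * N) => f m).prod =
      (List.ofFn fun k : Fin N => f (2 * k) * f (2 * k + 1)).prod := by
  induction N with
  | zero => simp
  | succ N ih =>
    have h : (List.ofFn fun m : Fin (2 * (N + 1)) => f m) =
        List.ofFn fun m : Fin (2 * N + 1 + 1) => f m := rfl
    rw [h]
    simp only [List.ofFn_succ', List.concat_eq_append, List.prod_append, List.prod_singleton,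
      Fin.val_castSucc, Fin.val_last, ih, mul_assoc]

/-- The backward branch is stored with time decreasing along the sites, so pair `k` in time is
counted from the end. -/
theorem prod_reverse_ofFn_pairs {M : Type*} [Monoid M] (f : ℕ → M) (N : ℕ) :
    (List.ofFn fun m : Fin (2 * N) => f m).prod =
      (List.ofFn fun k : Fin N =>
        f (2 * N - 1 - (2 * k + 1)) * f (2 * N - 1 - 2 * k)).reverse.prod := by
  induction N with
  | zero => simp
  | succ N ih =>
    have h : (List.ofFn fun m : Fin (2 * (N + 1)) => f m) =
        List.ofFn fun m : Fin (2 * N + 1 + 1) => f m := rfl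
    have e : ∀ k : ℕ, 2 * (N + 1) - 1 - (2 * (k + 1) + 1) = 2 * N - 1 - (2 * k + 1) ∧
        2 * (N + 1) - 1 - 2 * (k + 1) = 2 * N - 1 - 2 * k := fun k => by omega
    have e' : 2 * (N + 1) - 1 - (2 * 0 + 1) = 2 * N ∧ 2 * (N + 1) - 1 - 2 * 0 = 2 * N + 1 := by
      omega
    rw [h]
    simp only [List.ofFn_succ' (n := 2 * N), List.ofFn_succ' (n := 2 * N + 1),
      List.concat_eq_append, List.prod_append, List.prod_singleton,
      Fin.val_castSucc, Fin.val_last, ih, mul_assoc]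
    simp only [List.ofFn_succ (n := N), Fin.val_zero, Fin.val_succ, List.reverse_cons,
      List.prod_append, List.prod_singleton, e, e']

theorem siteMat_of_lt_of_odd {N k : ℕ} (η u v : ℂ) (x y : Fin 2) (h : 2 * N < k) (hk : Odd k) :
    siteMat N η u v k x y = auxMat η v x y := by
  rw [siteMat, if_pos h, if_neg (Nat.not_even_iff_odd.2 hk)]

theorem siteMat_of_lt_of_even {N k : ℕ} (η u v : ℂ) (x y : Fin 2) (h : 2 * N < k) (hk : Even k) :
    siteMat N η u v k x y = auxMat η (u - v) y x := by
  rw [siteMat, if_pos h, if_pos hk]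

theorem siteMat_of_le_of_odd {N k : ℕ} (η u v : ℂ) (x y : Fin 2) (h : k ≤ 2 * N) (hk : Odd k) :
    siteMat N η u v k x y = auxMat η (v - u) x y := by
  rw [siteMat, if_neg h.not_gt, if_neg (Nat.not_even_iff_odd.2 hk)]

theorem siteMat_of_le_of_even {N k : ℕ} (η u v : ℂ) (x y : Fin 2) (h : k ≤ 2 * N) (hk : Even k) :
    siteMat N η u v k x y = auxMat η (-v) y x := by
  rw [siteMat, if_neg h.not_gt, if_pos hk]

theorem timeSteps_bijective (N : ℕ) : Function.Bijective (timeSteps N) := by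
  rw [Fintype.bijective_iff_injective_and_card]
  constructor
  · intro w w' h
    funext i
    obtain ⟨i, hi⟩ := i
    have hk : ∀ k : Fin N, timeSteps N w k = timeSteps N w' k := fun k => congrFun h k
    simp only [timeSteps, Prod.mk.injEq] at hk
    rcases lt_or_ge i (2 * N) with h1 | h1
    · rcases Nat.even_or_odd' (2 * N - 1 - i) with ⟨k, hk' | hk'⟩
      · have := (hk ⟨k, by omega⟩).2.2
        have e : i = 2 * N - 1 - 2 * k := by omega
        subst e
        exact this
      · have := (hk ⟨k, by omega⟩).2.1
        have e : i = 2 * N - 1 - (2 * k + 1) := by omega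
        subst e
        exact this
    · rcases Nat.even_or_odd' (i - 2 * N) with ⟨k, hk' | hk'⟩
      · have := (hk ⟨k, by omega⟩).1.1
        have e : i = 2 * N + 2 * k := by omega
        subst e
        exact this
      · have := (hk ⟨k, by omega⟩).1.2
        have e : i = 2 * N + (2 * k + 1) := by omega
        subst e
        exact this
  · simp only [Fintype.card_fun, Fintype.card_prod, Fintype.card_fin]
    rw [pow_mul]
    norm_num

theorem transferMatrix_apply (N : ℕ) (η u q v : ℂ) (w w' : Fin (4 * N) → Fin 2) :
    transferMatrix N η u q v w w' =
      (rho q * auxPath η u v N (timeSteps N w) (timeSteps N w')).trace := by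
  -- The extension by 0 is never evaluated out of range; it lets the pairing lemmas use functions on
  -- ℕ.
  let W : ℕ → Fin 2 := fun m => if h : m < 4 * N then w ⟨m, h⟩ else 0
  let W' : ℕ → Fin 2 := fun m => if h : m < 4 * N then w' ⟨m, h⟩ else 0
  have hW : ∀ m (h : m < 4 * N), w ⟨m, h⟩ = W m := fun m h => by simp [W, h]
  have hW' : ∀ m (h : m < 4 * N), w' ⟨m, h⟩ = W' m := fun m h => by simp [W', h]
  have hrho : (rho q)ᵀ = rho q := by rw [rho_eq_diagonal, Matrix.diagonal_transpose]
  have h1 : transferMatrix N η u q v w w' =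
      (rho q *
        ((List.ofFn fun m : Fin (2 * N) =>
          siteMat N η u v (2 * N + 1 + (m : ℕ)) (W (2 * N + m)) (W' (2 * N + m))).prod *
        (List.ofFn fun m : Fin (2 * N) => siteMat N η u v (1 + (m : ℕ)) (W m) (W' m)).prod)).trace := by
    -- Transposing inside the trace reverses the descending order of sites and removes the
    -- transposes on the site matrices; cyclicity puts ρ(q) in front.
    rw [← mul_assoc, Matrix.trace_mul_comm, ← mul_assoc, ← Matrix.trace_transpose]
    simp only [transferMatrix, monodromy_apply, Matrix.transpose_mul, Matrix.transpose_list_prod,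
      List.map_ofFn, hrho, hW, hW']
    simp [Matrix.trace, mul_assoc, Function.comp_def]
  rw [h1, auxPath, nestedProd_eq]
  congr 3
  · rw [prod_ofFn_pairs fun m => siteMat N η u v (2 * N + 1 + m) (W (2 * N + m)) (W' (2 * N + m))]
    congr 2
    funext k
    rw [siteMat_of_lt_of_odd _ _ _ _ _ (by omega) ⟨N + k, by ring⟩,
      siteMat_of_lt_of_even _ _ _ _ _ (by omega) ⟨N + k + 1, by ring⟩]
    simp only [timeSteps, hW, hW']
  · rw [prod_reverse_ofFn_pairs fun m => siteMat N η u v (1 + m) (W m) (W' m)]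
    congr 3
    funext k
    have hk := k.2
    rw [siteMat_of_le_of_odd _ _ _ _ _ (by omega) ⟨N - 1 - k, by omega⟩,
      siteMat_of_le_of_even _ _ _ _ _ (by omega) ⟨N - k, by omega⟩]
    simp only [timeSteps, hW, hW']

end

end XXZFloquet

/-! ### The eigenvector statement -/

theorem mainTheorem1 (N : ℕ) (η u q : ℂ)
    (hq : q ≠ 0) (hq' : q + q⁻¹ ≠ 0)
    -- the gate is defined and invertible
    (hu : Complex.sinh (u + η) ≠ 0) (hu' : Complex.sinh (-u + η) ≠ 0) :
    -- baths of at least `2N` sites, hence the semi-infinite bath, have one influence matrix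
    (∀ L : ℕ, 2 * N ≤ L →
      XXZFloquet.influenceVector N L η u q = XXZFloquet.influenceVector N (2 * N) η u q) ∧
    -- it is an eigenvector of `T(v)` at every `v` where the entries of `T(v)` have no pole
    (∀ v : ℂ,
      Complex.sinh (v + η) ≠ 0 → Complex.sinh (-v + η) ≠ 0 →
      Complex.sinh (u - v + η) ≠ 0 → Complex.sinh (v - u + η) ≠ 0 →
      Module.End.HasEigenvector
        (Matrix.toLin' (XXZFloquet.transferMatrix N η u q v)) 1
        (XXZFloquet.influenceVector N (2 * N) η u q)) := by
  open XXZFloquet in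
  refine ⟨fun L hL => influenceVector_eq hL hq' hu hu', fun v hv hv' huv huv' => ⟨?_, ?_⟩⟩
  · rw [Module.End.mem_eigenspace_iff, one_smul, Matrix.toLin'_apply]
    funext w
    rw [influenceVector_eq_influence, ← influence_dressedFloquet hq' hu hu' hv hv' huv huv',
      influence_dressedFloquet_eq_sum hu hu' hv hv' huv huv']
    simp only [Matrix.mulVec, dotProduct, influenceVector_eq_influence, transferMatrix_apply]
    exact Fintype.sum_bijective _ (timeSteps_bijective N) _ _ fun _ => rfl
  · intro h0
    obtain ⟨p, hp⟩ := exists_influence_ne_zero (L := 2 * N) hq'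
      (isUnit_floquet (η := η) (u := u) hu hu') N
    obtain ⟨w, rfl⟩ := (timeSteps_bijective N).2 p
    rw [← influenceVector_eq_influence, h0] at hp
    exact hp rfl
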